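/- A class $\mathcal F$ of functions $\mathbb N^n\to\mathbb N$ (all arities $n$) is called \emph{good} if it contains the constant functions, the projections, the successor function and the modified difference $x\dot- y=\max\{0,x-y\}$, and is closed under composition and bounded summation $f(\bar x,y)=\sum_{i=0}^{y}g(\bar x,i)$. Regard $\mathbb Z$ as a retract of $\mathbb N^2$ via $\iota(z)=(\max(z,0),-\min(z,0))$, $\pi(n,m)=n-m$, regard $\mathbb Q$ as a retract of $\mathbb Z\times\mathbb N$ via $\iota(r)=(z,n)$, where $r=\frac zn$ in lowest terms with $n>0$, and $\pi(z,n)=\frac zn$ for $n>0$, $\pi(z,0)=0$, and regard finite products of such sets as retracts of powers of $\mathbb N$ componentwise. A function $f:X\to X'$ between such sets is an \emph{$\mathcal F$-function} if all components of $\iota'\circ f\circ\pi$ belong to $\mathcal F$. Use the maximum norm on $\mathbb R^N$. For an open set $O\subseteq\mathbb R^N$ and an integer $e>0$ let $O_e$ be the set of all $x\in O$ with $|x|\le e$ and $\operatorname{dist}(x,\mathbb R^N\setminus O)\ge\frac1e$ (the last condition being void if $O=\mathbb R^N$). A function $F:O\to\mathbb R^M$ is \emph{in $\mathcal F$} if there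 are $\mathcal F$-functions $d:\mathbb N\to\mathbb N$, strictly increasing, and $f:\mathbb Q^N\times\mathbb N\to\mathbb Q^M$ such that for all integers $e>0$, all $a\in\mathbb Q^N$ and all $x\in O_e$ $$|x-a|<\tfrac1{d(e)}\ \Longrightarrow\ |F(x)-f(a,e)|<\tfrac1e .$$ A function $F:A\to\mathbb R^M$ on a compact set $A\subset\mathbb R^N$ is \emph{in $\mathcal F$} if the same holds with all $x\in A$ in place of all $x\in O_e$. Identify $\mathbb C$ with $\mathbb R^2$. \textbf{Theorem.} Let $\mathcal F$ be a good class, let $D\subset\mathbb C$ be a domain (open and connected) and let $F$ be a holomorphic function on $D$. If the restriction of $F$ to some non-empty open subset of $D$ is in $\mathcal F$, then the restriction of $F$ to every compact subset of $D$ is in $\mathcal F$. -/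

import Mathlib

/-- A class of functions `ℕⁿ → ℕ`, for all arities `n`. -/
abbrev FunClass : Type := (n : ℕ) → Set ((Fin n → ℕ) → ℕ)

/-- Good classes: they contain the constants, the projections, the successor and the modified
difference (truncated subtraction), and are closed under composition and bounded summation
`f(x̄, y) = ∑_{i = 0}^{y} g(x̄, i)`. -/
structure FunClass.IsGood (𝓕 : FunClass) : Prop where
  const : ∀ n c : ℕ, (fun _ : Fin n → ℕ => c) ∈ 𝓕 n
  proj : ∀ (n : ℕ) (i : Fin n), (fun v : Fin n → ℕ => v i) ∈ 𝓕 n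
  succ : (fun v : Fin 1 → ℕ => v 0 + 1) ∈ 𝓕 1
  monus : (fun v : Fin 2 → ℕ => v 0 - v 1) ∈ 𝓕 2
  comp : ∀ (m n : ℕ) (g : (Fin m → ℕ) → ℕ) (h : Fin m → (Fin n → ℕ) → ℕ),
    g ∈ 𝓕 m → (∀ i, h i ∈ 𝓕 n) → (fun v : Fin n → ℕ => g (fun i => h i v)) ∈ 𝓕 n
  boundedSum : ∀ (n : ℕ) (g : (Fin (n + 1) → ℕ) → ℕ), g ∈ 𝓕 (n + 1) →
    (fun v : Fin (n + 1) → ℕ =>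
      ∑ i ∈ Finset.range (v (Fin.last n) + 1), g (Fin.snoc (Fin.init v) i)) ∈ 𝓕 (n + 1)

/-- The data of a retract of `ℕⁿ`: maps `ι : X → ℕⁿ` and `π : ℕⁿ → X` with `π ∘ ι = id`.
Only the explicit retractions below (for `ℕ`, `ℤ`, `ℚ` and their finite products) are used;
for them `ι ∘ π` lies in every good class. -/
structure Retract (X : Type) where
  dim : ℕ
  ι : X → (Fin dim → ℕ)
  π : (Fin dim → ℕ) → X
  π_ι : ∀ x, π (ι x) = x

namespace Retract

/-- A retract of a retract. -/
def trans {X Y : Type} (c : Retract Y) (i : X → Y) (p : Y → X) (h : ∀ x, p (i x) = x) :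
    Retract X where
  dim := c.dim
  ι := fun x => c.ι (i x)
  π := fun v => p (c.π v)
  π_ι := fun x => by rw [c.π_ι, h]

/-- The product of two retracts. -/
def prod {X Y : Type} (c : Retract X) (c' : Retract Y) : Retract (X × Y) where
  dim := c.dim + c'.dim
  ι := fun p => Fin.append (c.ι p.1) (c'.ι p.2)
  π := fun v => (c.π (fun i => v (Fin.castAdd c'.dim i)), c'.π (fun i => v (Fin.natAdd c.dim i)))
  π_ι := fun p => by simp [c.π_ι, c'.π_ι]

/-- The `N`-th power of a retract. -/
def pow {X : Type} (c : Retract X) (N : ℕ) : Retract (Fin N → X) where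
  dim := N * c.dim
  ι := fun x j => c.ι (x (finProdFinEquiv.symm j).1) (finProdFinEquiv.symm j).2
  π := fun v i => c.π (fun k => v (finProdFinEquiv (i, k)))
  π_ι := fun x => by funext i; simp only [Equiv.symm_apply_apply, c.π_ι]

/-- `ℕ` as a retract of `ℕ¹`. -/
def nat : Retract ℕ where
  dim := 1
  ι := fun n _ => n
  π := fun v => v 0
  π_ι := fun _ => rfl

/-- `ℤ` as a retract of `ℕ²`: `ι z = (max z 0, -min z 0)` and `π (n, m) = n - m`. -/
def int : Retract ℤ where
  dim := 2
  ι := fun z => ![z.toNat, (-z).toNat]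
  π := fun v => (v 0 : ℤ) - (v 1 : ℤ)
  π_ι := fun z => by simp

/-- `ℚ` as a retract of `ℤ × ℕ`: `ι r` is the pair of numerator and denominator of `r` in lowest
terms, and `π (z, n)` is `z / n` for `n > 0` and `0` for `n = 0` (which is also the value of
`z / 0` in `ℚ`). -/
def rat : Retract ℚ :=
  (int.prod nat).trans (fun r => (r.num, r.den)) (fun p => (p.1 : ℚ) / (p.2 : ℚ))
    (fun r => Rat.num_div_den r)

end Retract

/-- A function between retracts belongs to `𝓕` if all the components of `ι' ∘ f ∘ π` do. -/
def FunClass.Has (𝓕 : FunClass) {X Y : Type} (c : Retract X) (c' : Retract Y) (f : X → Y) : Prop :=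
  ∀ j : Fin c'.dim, (fun v : Fin c.dim → ℕ => c'.ι (f (c.π v)) j) ∈ 𝓕 c.dim

/-- `f(·, e)` approximates `F` on `S` with precision `1/e` and modulus `d(e)`: if
`a ∈ ℚᴺ`, `x ∈ S` and `|x - a| < 1/d(e)`, then `|F(x) - f(a, e)| < 1/e`.
The norm on `Fin N → ℝ` is the maximum norm. -/
def ApproximatesAt {N M : ℕ} (d : ℕ → ℕ) (f : (Fin N → ℚ) × ℕ → (Fin M → ℚ)) (e : ℕ)
    (S : Set (Fin N → ℝ)) (F : (Fin N → ℝ) → (Fin M → ℝ)) : Prop :=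
  ∀ a : Fin N → ℚ, ∀ x ∈ S, ‖x - (fun i => (a i : ℝ))‖ < 1 / (d e : ℝ) →
    ‖F x - (fun j => (f (a, e) j : ℝ))‖ < 1 / (e : ℝ)

/-- `O_e`: the points `x ∈ O` with `|x| ≤ e` whose distance to the complement of `O` is at least
`1/e` (no condition if the complement is empty). -/
def innerPart {N : ℕ} (O : Set (Fin N → ℝ)) (e : ℕ) : Set (Fin N → ℝ) :=
  {x | x ∈ O ∧ ‖x‖ ≤ (e : ℝ) ∧ ∀ y, y ∉ O → 1 / (e : ℝ) ≤ ‖x - y‖}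

/-- The restriction of `F` to the open set `O ⊆ ℝᴺ` is in `𝓕`. (The modulus `d` is required to
be strictly increasing, so that `d(e) > 0` for `e > 0`.) -/
def FunClass.HasOnOpen (𝓕 : FunClass) {N M : ℕ} (O : Set (Fin N → ℝ))
    (F : (Fin N → ℝ) → (Fin M → ℝ)) : Prop :=
  ∃ (d : ℕ → ℕ) (f : (Fin N → ℚ) × ℕ → (Fin M → ℚ)), StrictMono d ∧
    𝓕.Has Retract.nat Retract.nat d ∧
    𝓕.Has ((Retract.rat.pow N).prod Retract.nat) (Retract.rat.pow M) f ∧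
    ∀ e : ℕ, 0 < e → ApproximatesAt d f e (innerPart O e) F

/-- The restriction of `F` to the compact set `A ⊆ ℝᴺ` is in `𝓕`. -/
def FunClass.HasOnCompact (𝓕 : FunClass) {N M : ℕ} (A : Set (Fin N → ℝ))
    (F : (Fin N → ℝ) → (Fin M → ℝ)) : Prop :=
  ∃ (d : ℕ → ℕ) (f : (Fin N → ℚ) × ℕ → (Fin M → ℚ)), StrictMono d ∧
    𝓕.Has Retract.nat Retract.nat d ∧
    𝓕.Has ((Retract.rat.pow N).prod Retract.nat) (Retract.rat.pow M) f ∧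
    ∀ e : ℕ, 0 < e → ApproximatesAt d f e A F

/-- The identification of `ℂ` with `ℝ²`. -/
def planeEquiv : ℂ ≃ (Fin 2 → ℝ) where
  toFun := fun z => ![z.re, z.im]
  invFun := fun v => ⟨v 0, v 1⟩
  left_inv := fun _ => rfl
  right_inv := fun v => by funext i; fin_cases i <;> rfl

/-- A map `ℂ → ℂ` read as a map `ℝ² → ℝ²`. -/
def realForm (F : ℂ → ℂ) : (Fin 2 → ℝ) → (Fin 2 → ℝ) :=
  fun v => planeEquiv (F (planeEquiv.symm v))

/-! A good class need not contain exponentiation, so power series cannot be summed naively. But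
precision `1/e` needs only about `log e` terms, and then all coefficients are polynomially bounded
in `e`. Suppose `F` is approximable on the disc of radius `r` about `c` and holomorphic on a disc of
radius above `64 r`. For `x` within `2 r` of `c`, sample `F` at `c + (j / 2N)(x - c)` for `j ≤ N`.
These nodes lie in the small disc, and Newton's forward difference formula truncated at order `N`
predicts `F x`, the value at `j = 2N`, up to `O(2^{-N})` (`exists_extrapolation_bound`). Sample
errors are amplified by at most `9^N`. With `N = (2 * M * e).size` this is polynomial in `e`, and
the binomial coefficients belong to the class by counting binary words. So the disc can be doubled
(`approx_closedBall_two_mul`).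

In `Approx` the values are Gaussian integers over a denominator depending on `e` alone, so the
formula becomes a bounded sum of integers.

Repeated doubling reaches a fixed fraction of any disc inside `D`. Hence the points with an
approximable neighbourhood form a relatively closed set; it is also open and meets `D`, so it
contains `D`. A compact set is covered by finitely many discs, glued by a test on the rational
argument (`approx_union_closedBall`). The finitely many constants involved are free, since every
constant is in the class. -/

/-! ### Arithmetic and bounded quantifiers in a good class -/

namespace FunClass

/-- The zero set of some member of the class. -/
def Pred (𝓕 : FunClass) {n : ℕ} (P : (Fin n → ℕ) → Prop) : Prop :=
  ∃ χ ∈ 𝓕 n, ∀ v, χ v = 0 ↔ P v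

theorem Pred.congr {𝓕 : FunClass} {n : ℕ} {P Q : (Fin n → ℕ) → Prop} (hP : 𝓕.Pred P)
    (hPQ : ∀ v, P v ↔ Q v) :
    𝓕.Pred Q := by
  obtain ⟨χ, hχ, hχP⟩ := hP
  exact ⟨χ, hχ, fun v => (hχP v).trans (hPQ v)⟩

namespace IsGood

variable {𝓕 : FunClass} (h : 𝓕.IsGood) {n : ℕ}

include h

theorem comp₁ {f : ℕ → ℕ} (hf : (fun v : Fin 1 → ℕ => f (v 0)) ∈ 𝓕 1)
    {a : (Fin n → ℕ) → ℕ} (ha : a ∈ 𝓕 n) : (fun v => f (a v)) ∈ 𝓕 n :=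
  h.comp 1 n _ ![a] hf (by simpa [Fin.forall_fin_succ] using ha)

theorem comp₂ {f : ℕ → ℕ → ℕ} (hf : (fun v : Fin 2 → ℕ => f (v 0) (v 1)) ∈ 𝓕 2)
    {a b : (Fin n → ℕ) → ℕ} (ha : a ∈ 𝓕 n) (hb : b ∈ 𝓕 n) :
    (fun v => f (a v) (b v)) ∈ 𝓕 n :=
  h.comp 2 n _ ![a, b] hf (by simpa [Fin.forall_fin_succ] using ⟨ha, hb⟩)

theorem sub {a b : (Fin n → ℕ) → ℕ} (ha : a ∈ 𝓕 n) (hb : b ∈ 𝓕 n) :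
    (fun v => a v - b v) ∈ 𝓕 n :=
  h.comp₂ (f := fun x y => x - y) h.monus ha hb

theorem add_one {a : (Fin n → ℕ) → ℕ} (ha : a ∈ 𝓕 n) : (fun v => a v + 1) ∈ 𝓕 n :=
  h.comp₁ (f := fun x => x + 1) h.succ ha

/-- Summing a constant term over `0, …, y` gives `(y + 1) * x`; the surplus `x` is subtracted. -/
theorem mul {a b : (Fin n → ℕ) → ℕ} (ha : a ∈ 𝓕 n) (hb : b ∈ 𝓕 n) :
    (fun v => a v * b v) ∈ 𝓕 n := by
  have key := h.boundedSum 1 (fun v => v 0) (h.proj 2 0)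
  have key' : (fun v : Fin 2 → ℕ => (v 1 + 1) * v 0) ∈ 𝓕 2 := by
    convert key using 2 with v
    have : ∀ i : ℕ, (Fin.snoc (Fin.init v) i : Fin 2 → ℕ) 0 = v 0 := fun i => rfl
    simp [this]
  have := h.sub (h.comp₂ (f := fun x y => (y + 1) * x) key' ha hb) ha
  convert this using 2 with v
  rw [add_mul, one_mul, Nat.add_sub_cancel, mul_comm]

/-- Addition comes after multiplication: `a + b = (a + 1) * (b + 1) - a * b - 1`. -/
theorem add {a b : (Fin n → ℕ) → ℕ} (ha : a ∈ 𝓕 n) (hb : b ∈ 𝓕 n) :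
    (fun v => a v + b v) ∈ 𝓕 n := by
  have := h.sub (h.sub (h.mul (h.add_one ha) (h.add_one hb)) (h.mul ha hb)) (h.const n 1)
  convert this using 2 with v
  rw [show (a v + 1) * (b v + 1) = a v * b v + (a v + b v + 1) by ring]
  simp

theorem weaken {a : (Fin n → ℕ) → ℕ} (ha : a ∈ 𝓕 n) :
    (fun w : Fin (n + 1) → ℕ => a (Fin.init w)) ∈ 𝓕 (n + 1) :=
  h.comp n (n + 1) a (fun i w => w i.castSucc) ha (fun _ => h.proj _ _)

theorem last : (fun w : Fin (n + 1) → ℕ => w (Fin.last n)) ∈ 𝓕 (n + 1) := h.proj _ _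

theorem subst {g : (Fin (n + 1) → ℕ) → ℕ} (hg : g ∈ 𝓕 (n + 1))
    {b : (Fin n → ℕ) → ℕ} (hb : b ∈ 𝓕 n) :
    (fun v => g (Fin.snoc v (b v))) ∈ 𝓕 n := by
  refine h.comp (n + 1) n g (fun i v => (Fin.snoc v (b v) : Fin (n + 1) → ℕ) i) hg ?_
  intro i
  induction i using Fin.lastCases with
  | last => simpa using hb
  | cast i => simpa using h.proj n i

theorem sum {f : (Fin n → ℕ) → ℕ → ℕ}
    (hf : (fun w : Fin (n + 1) → ℕ => f (Fin.init w) (w (Fin.last n))) ∈ 𝓕 (n + 1))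
    {b : (Fin n → ℕ) → ℕ} (hb : b ∈ 𝓕 n) :
    (fun v => ∑ i ∈ Finset.range (b v), f v i) ∈ 𝓕 n := by
  -- The inclusive sum minus its last term; this also handles the empty range.
  have := h.sub (h.subst (h.boundedSum n _ hf) hb) (h.subst hf hb)
  convert this using 2 with v
  simp [Finset.sum_range_succ]

theorem pred_le {a b : (Fin n → ℕ) → ℕ} (ha : a ∈ 𝓕 n) (hb : b ∈ 𝓕 n) :
    𝓕.Pred (fun v => a v ≤ b v) :=
  ⟨_, h.sub ha hb, fun _ => Nat.sub_eq_zero_iff_le⟩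

theorem pred_and {P Q : (Fin n → ℕ) → Prop} (hP : 𝓕.Pred P) (hQ : 𝓕.Pred Q) :
    𝓕.Pred (fun v => P v ∧ Q v) := by
  obtain ⟨χ, hχ, hχP⟩ := hP
  obtain ⟨ψ, hψ, hψQ⟩ := hQ
  exact ⟨_, h.add hχ hψ, fun v => by simp [hχP, hψQ]⟩

theorem pred_not {P : (Fin n → ℕ) → Prop} (hP : 𝓕.Pred P) : 𝓕.Pred (fun v => ¬ P v) := by
  obtain ⟨χ, hχ, hχP⟩ := hP
  refine ⟨_, h.sub (h.const n 1) hχ, fun v => ?_⟩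
  have := hχP v
  simp only [← this]
  omega

theorem pred_eq {a b : (Fin n → ℕ) → ℕ} (ha : a ∈ 𝓕 n) (hb : b ∈ 𝓕 n) :
    𝓕.Pred (fun v => a v = b v) :=
  Pred.congr (h.pred_and (h.pred_le ha hb) (h.pred_le hb ha)) (fun _ => le_antisymm_iff.symm)

theorem pred_imp {P Q : (Fin n → ℕ) → Prop} (hP : 𝓕.Pred P) (hQ : 𝓕.Pred Q) :
    𝓕.Pred (fun v => P v → Q v) :=
  Pred.congr (h.pred_not (h.pred_and hP (h.pred_not hQ))) (fun v => by tauto)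

theorem pred_forall {P : (Fin n → ℕ) → ℕ → Prop}
    (hP : 𝓕.Pred (fun w : Fin (n + 1) → ℕ => P (Fin.init w) (w (Fin.last n))))
    {b : (Fin n → ℕ) → ℕ} (hb : b ∈ 𝓕 n) :
    𝓕.Pred (fun v => ∀ i < b v, P v i) := by
  obtain ⟨χ, hχ, hχP⟩ := hP
  refine ⟨fun v => ∑ i ∈ Finset.range (b v), χ (Fin.snoc v i),
    h.sum (f := fun v i => χ (Fin.snoc v i)) ?_ hb, fun v => ?_⟩
  · simpa using hχ
  · simp [hχP]

theorem pred_exists {P : (Fin n → ℕ) → ℕ → Prop}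
    (hP : 𝓕.Pred (fun w : Fin (n + 1) → ℕ => P (Fin.init w) (w (Fin.last n))))
    {b : (Fin n → ℕ) → ℕ} (hb : b ∈ 𝓕 n) :
    𝓕.Pred (fun v => ∃ i < b v, P v i) :=
  Pred.congr (h.pred_not (h.pred_forall (P := fun v i => ¬ P v i) (h.pred_not hP) hb))
    (fun v => by push Not; rfl)

theorem ite {P : (Fin n → ℕ) → Prop} [∀ v, Decidable (P v)] (hP : 𝓕.Pred P)
    {a b : (Fin n → ℕ) → ℕ} (ha : a ∈ 𝓕 n) (hb : b ∈ 𝓕 n) :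
    (fun v => if P v then a v else b v) ∈ 𝓕 n := by
  obtain ⟨χ, hχ, hχP⟩ := hP
  have h1 := h.sub (h.const n 1) hχ
  have := h.add (h.mul h1 ha) (h.mul (h.sub (h.const n 1) h1) hb)
  convert this using 2 with v
  split_ifs with hv
  · simp [(hχP v).2 hv]
  · have : χ v ≠ 0 := fun h0 => hv ((hχP v).1 h0)
    simp [show 1 - χ v = 0 by omega]

theorem pred_dvd {a b : (Fin n → ℕ) → ℕ} (ha : a ∈ 𝓕 n) (hb : b ∈ 𝓕 n) :
    𝓕.Pred (fun v => a v ∣ b v) := by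
  refine Pred.congr (h.pred_exists (P := fun v i => b v = a v * i) (b := fun v => b v + 1)
    (h.pred_eq (h.weaken hb) (h.mul (h.weaken ha) h.last)) (h.add_one hb)) (fun v => ?_)
  constructor
  · rintro ⟨i, -, hi⟩
    exact ⟨i, hi⟩
  · rintro ⟨i, hi⟩
    rcases Nat.eq_zero_or_pos (a v) with h0 | h0
    · exact ⟨0, by omega, by simp [hi, h0]⟩
    · exact ⟨i, by rw [hi]; nlinarith, hi⟩

theorem div {a b : (Fin n → ℕ) → ℕ} (ha : a ∈ 𝓕 n) (hb : b ∈ 𝓕 n) :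
    (fun v => a v / b v) ∈ 𝓕 n := by
  -- The quotient counts the positive multiples of `b` up to `a`. The case `b = 0` is split off
  -- because the count would be `a`, not the default value `0`.
  have key := h.ite (h.pred_eq hb (h.const n 0)) (h.const n 0)
    (h.sum (f := fun v i => if (i + 1) * b v ≤ a v then 1 else 0)
      (h.ite (h.pred_le (h.mul (h.add_one h.last) (h.weaken hb)) (h.weaken ha))
        (h.const _ 1) (h.const _ 0)) ha)
  convert key using 2 with v
  split_ifs with h0
  · simp [h0]
  · rw [← Finset.card_filter]
    have : (Finset.range (a v)).filter (fun i => (i + 1) * b v ≤ a v) =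
        Finset.range (a v / b v) := by
      ext i
      have hb0 : 0 < b v := Nat.pos_of_ne_zero h0
      simp only [Finset.mem_filter, Finset.mem_range]
      rw [← Nat.le_div_iff_mul_le hb0, Nat.succ_le_iff]
      exact ⟨fun hi => hi.2, fun hi => ⟨hi.trans_le (Nat.div_le_self _ _), hi⟩⟩
    rw [this, Finset.card_range]

theorem mod {a b : (Fin n → ℕ) → ℕ} (ha : a ∈ 𝓕 n) (hb : b ∈ 𝓕 n) :
    (fun v => a v % b v) ∈ 𝓕 n := by
  convert h.sub ha (h.mul hb (h.div ha hb)) using 2 with v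
  have := Nat.div_add_mod (a v) (b v)
  omega

theorem pow {a : (Fin n → ℕ) → ℕ} (ha : a ∈ 𝓕 n) (k : ℕ) : (fun v => a v ^ k) ∈ 𝓕 n := by
  induction k with
  | zero => simpa using h.const n 1
  | succ k ih => simpa only [pow_succ] using h.mul ih ha

/-- The defining property of the gcd uses only bounded quantifiers, so summing `d` over all `d` that
have it returns the unique solution. The bound `a + b` covers the cases where one argument is zero.
-/
theorem gcd {a b : (Fin n → ℕ) → ℕ} (ha : a ∈ 𝓕 n) (hb : b ∈ 𝓕 n) :
    (fun v => Nat.gcd (a v) (b v)) ∈ 𝓕 n := by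
  classical
  have hP : 𝓕.Pred (fun w : Fin (n + 1) → ℕ =>
      (w (Fin.last n) ∣ a (Fin.init w) ∧ w (Fin.last n) ∣ b (Fin.init w)) ∧
      ∀ i < a (Fin.init w) + b (Fin.init w) + 1,
        i ∣ a (Fin.init w) → i ∣ b (Fin.init w) → i ∣ w (Fin.last n)) :=
    h.pred_and (h.pred_and (h.pred_dvd h.last (h.weaken ha)) (h.pred_dvd h.last (h.weaken hb)))
      (h.pred_forall (P := fun (w : Fin (n + 1) → ℕ) i => i ∣ a (Fin.init w) →
          i ∣ b (Fin.init w) → i ∣ w (Fin.last n))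
        (h.pred_imp (h.pred_dvd h.last (h.weaken (h.weaken ha)))
          (h.pred_imp (h.pred_dvd h.last (h.weaken (h.weaken hb)))
            (h.pred_dvd h.last (h.weaken h.last))))
        (h.add_one (h.add (h.weaken ha) (h.weaken hb))))
  have key := h.sum (f := fun v d => if (d ∣ a v ∧ d ∣ b v) ∧
      (∀ i < a v + b v + 1, i ∣ a v → i ∣ b v → i ∣ d) then d else 0)
    (h.ite hP h.last (h.const _ 0)) (h.add_one (h.add ha hb))
  convert key using 2 with v
  have hle : Nat.gcd (a v) (b v) < a v + b v + 1 := by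
    rcases Nat.eq_zero_or_pos (a v) with h0 | h0
    · simp [h0]
    · have := Nat.gcd_le_left (b v) h0
      omega
  rw [Finset.sum_eq_single (Nat.gcd (a v) (b v))]
  · rw [if_pos]
    exact ⟨⟨Nat.gcd_dvd_left _ _, Nat.gcd_dvd_right _ _⟩, fun i _ h1 h2 => Nat.dvd_gcd h1 h2⟩
  · intro d _ hne
    rw [if_neg]
    rintro ⟨⟨h1, h2⟩, h3⟩
    exact hne (Nat.dvd_antisymm (Nat.dvd_gcd h1 h2)
      (h3 _ hle (Nat.gcd_dvd_left _ _) (Nat.gcd_dvd_right _ _)))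
  · intro hn
    exact absurd (Finset.mem_range.2 hle) hn

end IsGood

end FunClass

/-! ### Binary digits and binomial coefficients without exponentiation -/

/-- The number of ones in the binary expansion of a number `s`. -/
def binaryWeight (s : ℕ) : ℕ := ∑ i ∈ Finset.range s.size, s / 2 ^ i % 2

-- Trades a sum over exponents for one over values, which needs only a test for being a power of
-- two.
open Classical in
theorem sum_range_powers_of_two (g : ℕ → ℕ) (E : ℕ) :
    ∑ i ∈ Finset.range E.size, g (2 ^ i) =
      ∑ p ∈ (Finset.range (E + 1)).filter (fun p => ∃ i, p = 2 ^ i), g p := by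
  have : (Finset.range (E + 1)).filter (fun p => ∃ i, p = 2 ^ i) =
      (Finset.range E.size).image (fun i => 2 ^ i) := by
    ext p
    simp only [Finset.mem_filter, Finset.mem_range, Finset.mem_image, Nat.lt_size]
    constructor
    · rintro ⟨hp, i, rfl⟩
      exact ⟨i, by omega, rfl⟩
    · rintro ⟨i, hi, rfl⟩
      exact ⟨by omega, i, rfl⟩
  rw [this, Finset.sum_image]
  intro i _ j _ hij
  exact Nat.pow_right_injective le_rfl hij

theorem binaryWeight_eq_of_size_le {s L : ℕ} (hL : s.size ≤ L) :
    binaryWeight s = ∑ i ∈ Finset.range L, s / 2 ^ i % 2 := by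
  refine Finset.sum_subset (Finset.range_mono hL) (fun i _ hi => ?_)
  have : s < 2 ^ i := Nat.size_le.1 (by simpa using hi)
  simp [Nat.div_eq_of_lt this]

theorem binaryWeight_two_mul_add (s : ℕ) {b : ℕ} (hb : b < 2) :
    binaryWeight (2 * s + b) = binaryWeight s + b := by
  have h1 : (2 * s + b).size ≤ s.size + 1 := by
    rw [Nat.size_le, pow_succ]
    have := Nat.lt_size_self s
    omega
  rw [binaryWeight_eq_of_size_le h1, binaryWeight, Finset.sum_range_succ']
  congr 1
  · refine Finset.sum_congr rfl (fun i _ => ?_)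
    rw [pow_succ', ← Nat.div_div_eq_div_mul, show (2 * s + b) / 2 = s by omega]
  · simp; omega

/-- Splitting by the last binary digit is Pascal's rule. -/
theorem card_binaryWeight_eq (m k : ℕ) :
    ((Finset.range (2 ^ m)).filter (fun s => binaryWeight s = k)).card = m.choose k := by
  classical
  induction m generalizing k with
  | zero => cases k <;> simp [binaryWeight, Finset.filter_singleton]
  | succ m ih =>
    have hsplit : (Finset.range (2 ^ (m + 1))).filter (fun s => binaryWeight s = k) =
        ((Finset.range (2 ^ m)).filter (fun s => binaryWeight s = k)).image (fun s => 2 * s) ∪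
        ((Finset.range (2 ^ m)).filter (fun s => binaryWeight s + 1 = k)).image
          (fun s => 2 * s + 1) := by
      ext s
      simp only [Finset.mem_filter, Finset.mem_range, Finset.mem_union, Finset.mem_image, pow_succ]
      constructor
      · rintro ⟨hs, hk⟩
        have hd : s = 2 * (s / 2) + s % 2 := by omega
        rw [hd, binaryWeight_two_mul_add _ (by omega)] at hk
        rcases Nat.mod_two_eq_zero_or_one s with h0 | h0
        · exact Or.inl ⟨s / 2, ⟨by omega, by omega⟩, by omega⟩
        · exact Or.inr ⟨s / 2, ⟨by omega, by omega⟩, by omega⟩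
      · rintro (⟨t, ⟨ht, hk⟩, rfl⟩ | ⟨t, ⟨ht, hk⟩, rfl⟩)
        · exact ⟨by omega, by simpa [hk] using binaryWeight_two_mul_add t (b := 0) (by omega)⟩
        · exact ⟨by omega, by rw [binaryWeight_two_mul_add t (by omega), hk]⟩
    rw [hsplit, Finset.card_union_of_disjoint, Finset.card_image_of_injective _
      (fun a b hab => by simpa using hab), Finset.card_image_of_injective _
      (fun a b hab => by simpa using hab), ih]
    · cases k with
      | zero => simp
      | succ k => simp [ih, Nat.choose_succ_succ, add_comm]
    · rw [Finset.disjoint_left]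
      simp only [Finset.mem_image, not_exists, not_and]
      rintro _ ⟨a, -, rfl⟩ b - hb
      omega

namespace FunClass.IsGood

variable {𝓕 : FunClass} (h : 𝓕.IsGood) {n : ℕ}

include h

/-- Powers of two are the positive numbers whose divisors other than `1` are all even, a condition
with bounded quantifiers only. -/
theorem pred_power_of_two {a : (Fin n → ℕ) → ℕ} (ha : a ∈ 𝓕 n) :
    𝓕.Pred (fun v => ∃ i, a v = 2 ^ i) := by
  have key : 𝓕.Pred (fun v => a v ≠ 0 ∧ ∀ d < a v + 1, d ∣ a v → ¬ d = 1 → 2 ∣ d) :=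
    h.pred_and (h.pred_not (h.pred_eq ha (h.const n 0)))
      (h.pred_forall (P := fun v d => d ∣ a v → ¬ d = 1 → 2 ∣ d)
        (h.pred_imp (h.pred_dvd h.last (h.weaken ha))
          (h.pred_imp (h.pred_not (h.pred_eq h.last (h.const _ 1)))
            (h.pred_dvd (h.const _ 2) h.last)))
        (h.add_one ha))
  refine Pred.congr key (fun v => ⟨fun ⟨h0, h1⟩ => ?_, ?_⟩)
  · rcases Nat.eq_two_pow_or_exists_odd_prime_and_dvd (a v) with ⟨k, hk⟩ | ⟨p, hp, hpd, hodd⟩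
    · exact ⟨k, hk⟩
    · have := h1 p (Nat.lt_succ_of_le (Nat.le_of_dvd (Nat.pos_of_ne_zero h0) hpd)) hpd hp.one_lt.ne'
      exact absurd hodd (Nat.not_odd_iff_even.2 (even_iff_two_dvd.2 this))
  · rintro ⟨i, hi⟩
    refine ⟨by rw [hi]; positivity, fun d _ hd hd1 => ?_⟩
    rw [hi] at hd
    obtain ⟨j, -, rfl⟩ := (Nat.dvd_prime_pow Nat.prime_two).1 hd
    exact dvd_pow_self 2 (fun hj => hd1 (by simp [hj]))

theorem sum_powers_of_two {g : (Fin n → ℕ) → ℕ → ℕ}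
    (hg : (fun w : Fin (n + 1) → ℕ => g (Fin.init w) (w (Fin.last n))) ∈ 𝓕 (n + 1))
    {a : (Fin n → ℕ) → ℕ} (ha : a ∈ 𝓕 n) :
    (fun v => ∑ i ∈ Finset.range (a v).size, g v (2 ^ i)) ∈ 𝓕 n := by
  classical
  have key := h.sum (f := fun v p => if ∃ i, p = 2 ^ i then g v p else 0)
    (h.ite (h.pred_power_of_two h.last) hg (h.const _ 0)) (h.add_one ha)
  convert key using 2 with v
  rw [sum_range_powers_of_two (g v), Finset.sum_filter]

theorem size {a : (Fin n → ℕ) → ℕ} (ha : a ∈ 𝓕 n) : (fun v => (a v).size) ∈ 𝓕 n := by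
  simpa using h.sum_powers_of_two (g := fun _ _ => 1) (h.const _ 1) ha

theorem binaryWeight {a : (Fin n → ℕ) → ℕ} (ha : a ∈ 𝓕 n) :
    (fun v => binaryWeight (a v)) ∈ 𝓕 n :=
  h.sum_powers_of_two (g := fun v p => a v / p % 2)
    (h.mod (h.div (h.weaken ha) h.last) (h.const _ 2)) ha

/-- Binomial coefficients `a.choose b` belong to the class in the range `2 ^ a ≤ c`. -/
theorem choose {a b c : (Fin n → ℕ) → ℕ} (ha : a ∈ 𝓕 n) (hb : b ∈ 𝓕 n) (hc : c ∈ 𝓕 n) :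
    ∃ f ∈ 𝓕 n, ∀ v, 2 ^ a v ≤ c v → f v = (a v).choose (b v) := by
  -- Counts the `s < c` with at most `a` binary digits and weight `b`. The bound `c` stands in for
  -- `2 ^ a`, which need not be in the class; if `2 ^ a ≤ c`, nothing is missed.
  refine ⟨_, h.sum (f := fun v s => if s.size ≤ a v ∧ _root_.binaryWeight s = b v then 1 else 0)
    (h.ite (h.pred_and (h.pred_le (h.size h.last) (h.weaken ha))
      (h.pred_eq (h.binaryWeight h.last) (h.weaken hb))) (h.const _ 1) (h.const _ 0)) hc,
    fun v hv => ?_⟩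
  rw [← Finset.card_filter, ← card_binaryWeight_eq]
  congr 1
  ext s
  simp only [Finset.mem_filter, Finset.mem_range, Nat.size_le]
  constructor
  · exact fun hs => hs.2
  · exact fun hs => ⟨hs.1.trans_le hv, hs⟩

end FunClass.IsGood

/-! ### Gaussian integer arithmetic and approximability -/

/-- The rational point of the plane with homogeneous coordinates `(s - s', t - t', q)`. -/
noncomputable def ratPoint (s s' t t' q : ℕ) : ℂ :=
  (((s : ℂ) - s') + ((t : ℂ) - t') * Complex.I) / q

namespace FunClass

/-- Gaussian integer valued functions all of whose components belong to the class. -/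
def Gaussian (𝓕 : FunClass) {n : ℕ} (f : (Fin n → ℕ) → ℂ) : Prop :=
  ∃ p ∈ 𝓕 n, ∃ p' ∈ 𝓕 n, ∃ q ∈ 𝓕 n, ∃ q' ∈ 𝓕 n,
    ∀ v, f v = ((p v : ℂ) - p' v) + ((q v : ℂ) - q' v) * Complex.I

theorem Gaussian.neg {𝓕 : FunClass} {n : ℕ} {f : (Fin n → ℕ) → ℂ} (hf : 𝓕.Gaussian f) :
    𝓕.Gaussian (fun v => - f v) := by
  obtain ⟨p, hp, p', hp', q, hq, q', hq', hf⟩ := hf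
  exact ⟨p', hp', p, hp, q', hq', q, hq, fun v => by simp only [hf]; ring⟩

namespace IsGood

variable {𝓕 : FunClass} (h : 𝓕.IsGood) {n : ℕ}

include h

theorem gaussian_natCast {a : (Fin n → ℕ) → ℕ} (ha : a ∈ 𝓕 n) :
    𝓕.Gaussian (fun v => (a v : ℂ)) :=
  ⟨a, ha, _, h.const n 0, _, h.const n 0, _, h.const n 0, fun v => by simp⟩

theorem gaussian_add {f g : (Fin n → ℕ) → ℂ} (hf : 𝓕.Gaussian f) (hg : 𝓕.Gaussian g) :
    𝓕.Gaussian (fun v => f v + g v) := by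
  obtain ⟨p, hp, p', hp', q, hq, q', hq', hf⟩ := hf
  obtain ⟨r, hr, r', hr', s, hs, s', hs', hg⟩ := hg
  refine ⟨_, h.add hp hr, _, h.add hp' hr', _, h.add hq hs, _, h.add hq' hs', fun v => ?_⟩
  simp only [hf, hg]
  push_cast
  ring

theorem gaussian_sub {f g : (Fin n → ℕ) → ℂ} (hf : 𝓕.Gaussian f) (hg : 𝓕.Gaussian g) :
    𝓕.Gaussian (fun v => f v - g v) := by
  simpa only [sub_eq_add_neg] using h.gaussian_add hf hg.neg

theorem gaussian_mul {f g : (Fin n → ℕ) → ℂ} (hf : 𝓕.Gaussian f) (hg : 𝓕.Gaussian g) :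
    𝓕.Gaussian (fun v => f v * g v) := by
  obtain ⟨p, hp, p', hp', q, hq, q', hq', hf⟩ := hf
  obtain ⟨r, hr, r', hr', s, hs, s', hs', hg⟩ := hg
  refine ⟨_, h.add (h.add (h.mul hp hr) (h.mul hp' hr')) (h.add (h.mul hq hs') (h.mul hq' hs)),
    _, h.add (h.add (h.mul hp hr') (h.mul hp' hr)) (h.add (h.mul hq hs) (h.mul hq' hs')),
    _, h.add (h.add (h.mul hp hs) (h.mul hp' hs')) (h.add (h.mul hq hr) (h.mul hq' hr')),
    _, h.add (h.add (h.mul hp hs') (h.mul hp' hs)) (h.add (h.mul hq hr') (h.mul hq' hr)),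
    fun v => ?_⟩
  simp only [hf, hg]
  push_cast
  linear_combination (((q v : ℂ) - q' v) * ((s v : ℂ) - s' v)) * Complex.I_mul_I

theorem gaussian_sum {f : (Fin n → ℕ) → ℕ → ℂ}
    (hf : 𝓕.Gaussian (fun w : Fin (n + 1) → ℕ => f (Fin.init w) (w (Fin.last n))))
    {b : (Fin n → ℕ) → ℕ} (hb : b ∈ 𝓕 n) :
    𝓕.Gaussian (fun v => ∑ i ∈ Finset.range (b v), f v i) := by
  obtain ⟨p, hp, p', hp', q, hq, q', hq', hf⟩ := hf
  have key : ∀ g ∈ 𝓕 (n + 1), (fun v => ∑ i ∈ Finset.range (b v), g (Fin.snoc v i)) ∈ 𝓕 n :=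
    fun g hg => h.sum (f := fun v i => g (Fin.snoc v i)) (by simpa using hg) hb
  refine ⟨_, key p hp, _, key p' hp', _, key q hq, _, key q' hq', fun v => ?_⟩
  have : ∀ i, f v i = ((p (Fin.snoc v i) : ℂ) - p' (Fin.snoc v i)) +
      ((q (Fin.snoc v i) : ℂ) - q' (Fin.snoc v i)) * Complex.I := fun i => by
    rw [← hf]
    simp
  simp only [this]
  push_cast
  rw [Finset.sum_add_distrib, Finset.sum_sub_distrib, ← Finset.sum_mul, Finset.sum_sub_distrib]

theorem gaussian_ite {P : (Fin n → ℕ) → Prop} [∀ v, Decidable (P v)] (hP : 𝓕.Pred P)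
    {f g : (Fin n → ℕ) → ℂ} (hf : 𝓕.Gaussian f) (hg : 𝓕.Gaussian g) :
    𝓕.Gaussian (fun v => if P v then f v else g v) := by
  have h1 : 𝓕.Gaussian (fun v => ((if P v then 1 else 0 : ℕ) : ℂ)) :=
    h.gaussian_natCast (h.ite hP (h.const n 1) (h.const n 0))
  have h2 : 𝓕.Gaussian (fun v => ((if P v then 0 else 1 : ℕ) : ℂ)) :=
    h.gaussian_natCast (h.ite hP (h.const n 0) (h.const n 1))
  convert h.gaussian_add (h.gaussian_mul h1 hf) (h.gaussian_mul h2 hg) using 2 with v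
  split_ifs <;> simp

theorem gaussian_comp {m : ℕ} {f : (Fin m → ℕ) → ℂ} (hf : 𝓕.Gaussian f)
    {a : Fin m → (Fin n → ℕ) → ℕ} (ha : ∀ i, a i ∈ 𝓕 n) :
    𝓕.Gaussian (fun v => f (fun i => a i v)) := by
  obtain ⟨p, hp, p', hp', q, hq, q', hq', hf⟩ := hf
  exact ⟨_, h.comp m n p a hp ha, _, h.comp m n p' a hp' ha, _, h.comp m n q a hq ha,
    _, h.comp m n q' a hq' ha, fun v => hf _⟩

/-- Comparing squares makes this an inequality between natural numbers. It is the test used to glue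
discs. -/
theorem pred_norm_le {f : (Fin n → ℕ) → ℂ} (hf : 𝓕.Gaussian f)
    {b : (Fin n → ℕ) → ℕ} (hb : b ∈ 𝓕 n) : 𝓕.Pred (fun v => ‖f v‖ ≤ b v) := by
  obtain ⟨p, hp, p', hp', q, hq, q', hq', hf⟩ := hf
  have hdist : ∀ {a a' : (Fin n → ℕ) → ℕ}, a ∈ 𝓕 n → a' ∈ 𝓕 n →
      (fun v => ((a v - a' v) + (a' v - a v)) ^ 2) ∈ 𝓕 n := fun ha ha' =>
    h.pow (h.add (h.sub ha ha') (h.sub ha' ha)) 2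
  have hsq : ∀ a a' : ℕ, ((((a - a') + (a' - a)) ^ 2 : ℕ) : ℝ) = ((a : ℝ) - a') ^ 2 := by
    intro a a'
    rcases le_total a a' with h' | h'
    · rw [Nat.sub_eq_zero_of_le h', zero_add]
      push_cast [Nat.cast_sub h']
      ring
    · rw [Nat.sub_eq_zero_of_le h', add_zero]
      push_cast [Nat.cast_sub h']
      ring
  refine Pred.congr (h.pred_le (h.add (hdist hp hp') (hdist hq hq')) (h.pow hb 2)) (fun v => ?_)
  rw [← Nat.cast_le (α := ℝ), Nat.cast_add, hsq, hsq, Nat.cast_pow,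
    ← sq_le_sq₀ (norm_nonneg _) (Nat.cast_nonneg _), Complex.sq_norm, Complex.normSq_apply, hf]
  simp [pow_two]

theorem gaussian_neg_one_pow {a : (Fin n → ℕ) → ℕ} (ha : a ∈ 𝓕 n) :
    𝓕.Gaussian (fun v => (-1 : ℂ) ^ a v) := by
  have key := h.gaussian_ite (h.pred_dvd (h.const n 2) ha) (h.gaussian_natCast (h.const n 1))
    (h.gaussian_natCast (h.const n 1)).neg
  convert key using 2 with v
  split_ifs with hv
  · simp [(even_iff_two_dvd.2 hv).neg_one_pow]
  · simp [(Nat.not_even_iff_odd.1 (fun h' => hv (even_iff_two_dvd.1 h'))).neg_one_pow]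

end IsGood

/-- Approximability of a function on a plane set to every precision `1 / e` by a member of the
class with Gaussian integer values and a common denominator `k e`. -/
def Approx (𝓕 : FunClass) (S : Set ℂ) (F : ℂ → ℂ) : Prop :=
  ∃ (d k : ℕ → ℕ) (g : (Fin 6 → ℕ) → ℂ),
    (fun v : Fin 1 → ℕ => d (v 0)) ∈ 𝓕 1 ∧ (fun v : Fin 1 → ℕ => k (v 0)) ∈ 𝓕 1 ∧
    (∀ e, 0 < d e) ∧ (∀ e, 0 < k e) ∧ 𝓕.Gaussian g ∧
    ∀ s s' t t' q e : ℕ, 0 < q → 0 < e → ∀ x ∈ S,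
      ‖x - ratPoint s s' t t' q‖ ≤ 1 / d e → ‖F x - g ![s, s', t, t', q, e] / k e‖ ≤ 1 / e

theorem Approx.mono {𝓕 : FunClass} {S T : Set ℂ} {F : ℂ → ℂ} (hT : 𝓕.Approx T F)
    (hST : S ⊆ T) : 𝓕.Approx S F := by
  obtain ⟨d, k, g, hd, hk, hd0, hk0, hg, H⟩ := hT
  exact ⟨d, k, g, hd, hk, hd0, hk0, hg,
    fun s s' t t' q e hq he x hx => H s s' t t' q e hq he x (hST hx)⟩

theorem IsGood.approx_empty {𝓕 : FunClass} (h : 𝓕.IsGood) (F : ℂ → ℂ) : 𝓕.Approx ∅ F :=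
  ⟨fun _ => 1, fun _ => 1, _, h.const 1 1, h.const 1 1, fun _ => one_pos, fun _ => one_pos,
    h.gaussian_natCast (h.const 6 0), fun _ _ _ _ _ _ _ _ _ hx => hx.elim⟩

end FunClass

/-! ### Newton extrapolation of holomorphic functions -/

-- The binomial coefficients of an `m`-th difference sum to `2 ^ m`.
open Finset in
theorem norm_fwdDiff_iter_le {θ : ℂ → ℂ} {η : ℝ} {m : ℕ} (hθ : ∀ j : ℕ, j ≤ m → ‖θ j‖ ≤ η) :
    ‖(fwdDiff 1)^[m] θ 0‖ ≤ 2 ^ m * η := by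
  rw [fwdDiff_iter_eq_sum_shift]
  refine (norm_sum_le _ _).trans ?_
  have : ∀ k ∈ range (m + 1), ‖((-1 : ℤ) ^ (m - k) * (m.choose k : ℤ)) • θ (0 + k • 1)‖ ≤
      (m.choose k : ℝ) * η := by
    intro k hk
    have hk' : k ≤ m := by simpa [Nat.lt_succ_iff] using hk
    rw [← Int.cast_smul_eq_zsmul ℂ, norm_smul]
    push_cast
    rw [norm_mul, norm_pow, norm_neg, norm_one, one_pow, one_mul, Complex.norm_natCast]
    gcongr
    simpa using hθ k hk'
  refine (sum_le_sum this).trans_eq ?_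
  rw [← sum_mul, ← Nat.cast_sum, Nat.sum_range_choose]
  push_cast
  rfl

open Finset in
/-- Truncation error of Newton's forward difference formula for a function close to a polynomial. -/
theorem norm_sub_newton_le {θ : ℂ → ℂ} {P : ℕ → ℂ} {η : ℝ} {n N : ℕ} (hnN : n ≤ N)
    (hθ : ∀ j : ℕ, j ≤ N → ‖θ j - ∑ k ∈ range (n + 1), P k * (j : ℂ) ^ k‖ ≤ η) :
    ‖θ N - ∑ m ∈ range (n + 1), (N.choose m : ℂ) * (fwdDiff 1)^[m] θ 0‖ ≤ 3 ^ N * η := by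
  have h0 : 0 ≤ η := (norm_nonneg _).trans (hθ 0 (Nat.zero_le _))
  set T : ℂ → ℂ := fun w => ∑ k ∈ range (n + 1), P k * w ^ k with hT
  -- Differences of order above `n` kill the polynomial `T`, leaving only those of the error `θ -
  -- T`.
  have hdiff : ∀ m, n < m → m ≤ N → ‖(fwdDiff 1)^[m] θ 0‖ ≤ 2 ^ m * η := by
    intro m hm hmN
    have hT0 : (fwdDiff 1)^[m] T = 0 := by
      have := fwdDiff_iter_sum_mul_pow_eq_zero (n := m) (R := ℂ)
        (fun k => if k < n + 1 then P k else 0)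
      rw [← this]
      congr 1
      ext w
      simp only [hT, ite_mul, zero_mul]
      rw [← sum_filter]
      congr 1
      ext k
      simp only [mem_range, mem_filter]
      omega
    have hsplit : θ = (θ - T) + T := by simp
    rw [hsplit, fwdDiff_iter_add, hT0, add_zero]
    exact norm_fwdDiff_iter_le (fun j hj => hθ j (hj.trans hmN))
  have hN := shift_eq_sum_fwdDiff_iter (1 : ℂ) θ N 0
  rw [zero_add, nsmul_one] at hN
  rw [hN, ← sum_range_add_sum_Ico _ (Nat.succ_le_succ hnN)]
  simp only [nsmul_eq_mul, add_sub_cancel_left]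
  refine (norm_sum_le _ _).trans ?_
  have h1 : ∀ m ∈ Ico (n + 1) (N + 1), ‖(N.choose m : ℂ) * (fwdDiff 1)^[m] θ 0‖ ≤
      2 ^ m * (N.choose m : ℝ) * η := by
    intro m hm
    rw [mem_Ico] at hm
    rw [norm_mul, Complex.norm_natCast, mul_comm (2 ^ m), mul_assoc]
    gcongr
    exact hdiff m hm.1 (Nat.lt_succ_iff.1 hm.2)
  refine (sum_le_sum h1).trans ?_
  -- Extending the range to all `m ≤ N` gives the binomial expansion of `(2 + 1) ^ N`.
  refine (sum_le_sum_of_subset_of_nonneg (t := range (N + 1)) (fun m hm => ?_)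
    (fun m _ _ => by positivity)).trans_eq ?_
  · rw [mem_Ico] at hm
    exact mem_range.2 hm.2
  · rw [← sum_mul]
    have := add_pow (2 : ℝ) 1 N
    norm_num at this
    rw [this]

open Finset in
/-- A holomorphic function is extrapolated, with exponentially small error, to twice the radius
from equidistant values on rays. -/
theorem exists_extrapolation_bound {F : ℂ → ℂ} {c : ℂ} {r R : ℝ} (hr : 0 < r) (hR : 64 * r < R)
    (hF : DifferentiableOn ℂ F (Metric.closedBall c R)) :
    ∃ M : ℕ, 0 < M ∧ ∀ x ∈ Metric.closedBall c (2 * r), ∀ n : ℕ, 0 < n →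
      ‖F x - ∑ m ∈ range (n + 1), ((2 * n).choose m : ℂ) * ∑ j ∈ range (m + 1),
        ((-1) ^ (m - j) * (m.choose j : ℂ)) * F (c + (j / (2 * n)) * (x - c))‖ ≤ M / 2 ^ n := by
  lift R to NNReal using by linarith
  have hR0 : 0 < R := by
    have : (0 : ℝ) < R := by linarith
    exact_mod_cast this
  have hps := hF.hasFPowerSeriesOnBall hR0
  set p := cauchyPowerSeries F c R
  obtain ⟨ρ, hρ⟩ : ∃ ρ : NNReal, (ρ : ℝ) = 64 * r := ⟨⟨64 * r, by positivity⟩, rfl⟩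
  have hr' : (ρ : ENNReal) < R := by
    rw [ENNReal.coe_lt_coe, ← NNReal.coe_lt_coe, hρ]
    exact hR
  obtain ⟨a, ha, C, hC, H⟩ := hps.uniform_geometric_approx' hr'
  rw [hρ] at H
  obtain ⟨M, hM⟩ := exists_nat_gt C
  refine ⟨M, by exact_mod_cast hC.trans hM, fun x hx n hn => ?_⟩
  have hnC : (n : ℂ) ≠ 0 := by exact_mod_cast hn.ne'
  rw [mem_closedBall_iff_norm] at hx
  -- The polynomial is the Taylor polynomial of degree `n` along the segment. On radius `2 r`,
  -- compared with `64 r`, its remainder is `C * (1 / 32) ^ (n + 1)`.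
  have key := norm_sub_newton_le (θ := fun w => F (c + (w / (2 * n)) * (x - c)))
    (P := fun k => ((x - c) / (2 * n)) ^ k * p.coeff k) (η := C * (1 / 32) ^ (n + 1))
    (n := n) (N := 2 * n) (by omega) (fun j hj => ?_)
  · have hend : ((2 * n : ℕ) : ℂ) / (2 * n) = 1 := by
      push_cast
      field_simp
    rw [hend, one_mul, add_sub_cancel] at key
    simp only [fwdDiff_iter_eq_sum_shift] at key
    refine le_trans (le_of_eq ?_) (key.trans ?_)
    · congr 3
      funext m
      congr 2
      funext j
      rw [← Int.cast_smul_eq_zsmul ℂ]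
      simp
    · have h1 : (3 : ℝ) ^ (2 * n) * (C * (1 / 32) ^ (n + 1)) = C * (9 / 32) ^ n * (1 / 32) := by
        rw [show (9 / 32 : ℝ) = 3 ^ 2 * (1 / 32) by norm_num, mul_pow, ← pow_mul]
        ring
      have h2 : (M : ℝ) / 2 ^ n = M * (2⁻¹) ^ n := by rw [inv_pow, div_eq_mul_inv]
      rw [h1, h2]
      calc C * (9 / 32 : ℝ) ^ n * (1 / 32) ≤ C * (9 / 32 : ℝ) ^ n * 1 := by
            gcongr
            norm_num
        _ ≤ M * (2⁻¹) ^ n := by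
            rw [mul_one]
            gcongr
            norm_num
  · have hj' : (j : ℝ) / (2 * n) ≤ 1 := by
      rw [div_le_one (by positivity)]
      exact_mod_cast hj
    have hy : ‖((j : ℂ) / (2 * n)) * (x - c)‖ ≤ 2 * r := by
      rw [norm_mul]
      have : ‖(j : ℂ) / (2 * n)‖ = (j : ℝ) / (2 * n) := by simp
      rw [this]
      calc (j : ℝ) / (2 * n) * ‖x - c‖ ≤ 1 * ‖x - c‖ := by gcongr
        _ ≤ 2 * r := by rwa [one_mul]
    have hb := H (((j : ℂ) / (2 * n)) * (x - c)) (by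
      rw [mem_ball_zero_iff]
      linarith) (n + 1)
    refine le_trans (le_of_eq ?_) (hb.trans ?_)
    · congr 2
      rw [FormalMultilinearSeries.partialSum]
      refine sum_congr rfl (fun k _ => ?_)
      rw [FormalMultilinearSeries.apply_eq_pow_smul_coeff, smul_eq_mul, mul_right_comm, ← mul_pow]
      congr 2
      ring
    · gcongr
      · exact mul_nonneg ha.1.le (by positivity)
      · calc a * (‖((j : ℂ) / (2 * n)) * (x - c)‖ / (64 * r)) ≤ 1 * (2 * r / (64 * r)) := by
              gcongr
              exact ha.2.le
          _ = 1 / 32 := by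
              field_simp
              norm_num

/-! ### Doubling a disc within the class -/

namespace FunClass.IsGood

variable {𝓕 : FunClass} (h : 𝓕.IsGood) {n : ℕ}

include h

theorem gaussian_sum_snoc {g : (Fin (n + 1) → ℕ) → ℂ} (hg : 𝓕.Gaussian g)
    {b : (Fin n → ℕ) → ℕ} (hb : b ∈ 𝓕 n) :
    𝓕.Gaussian (fun v => ∑ i ∈ Finset.range (b v), g (Fin.snoc v i)) :=
  h.gaussian_sum (f := fun v i => g (Fin.snoc v i)) (by simpa using hg) hb

open Finset in
/-- Coefficients of the extrapolation formula of order `(2 * M * e).size` belong to the class. -/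
theorem exists_gaussian_newton {g : (Fin 6 → ℕ) → ℂ} (hg : 𝓕.Gaussian g)
    (γ γ' δ δ' l M : ℕ) :
    ∃ G : (Fin 6 → ℕ) → ℂ, 𝓕.Gaussian G ∧ ∀ s s' t t' q e N : ℕ, 0 < e → 0 < M →
      (2 * M * e).size = N → G ![s, s', t, t', q, e] =
        ∑ m ∈ range (N + 1), ((2 * N).choose m : ℂ) * ∑ j ∈ range (m + 1),
          ((-1) ^ (m - j) * (m.choose j : ℂ)) *
            g ![γ * (2 * N - j) * q + j * l * s, γ' * (2 * N - j) * q + j * l * s',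
              δ * (2 * N - j) * q + j * l * t, δ' * (2 * N - j) * q + j * l * t',
              2 * N * l * q, 2 * e * (4 * M * e) ^ 4] := by
  have hsize : ∀ {n} (i : Fin n), (fun u : Fin n → ℕ => (2 * M * u i).size) ∈ 𝓕 n := fun i =>
    h.size (h.mul (h.const _ (2 * M)) (h.proj _ i))
  -- `(4 * M * e) ^ 2` majorizes `2 ^ (2 * N)`, as `choose` requires for both families of binomial
  -- coefficients.
  have hE : ∀ {n} (i : Fin n), (fun u : Fin n → ℕ => (4 * M * u i) ^ 2) ∈ 𝓕 n := fun i =>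
    h.pow (h.mul (h.const _ (4 * M)) (h.proj _ i)) 2
  obtain ⟨f₁, hf₁, hf₁'⟩ := h.choose (h.mul (h.const 7 2) (hsize 5)) (h.proj 7 6) (hE 5)
  obtain ⟨f₂, hf₂, hf₂'⟩ := h.choose (h.proj 8 6) (h.proj 8 7) (hE 5)
  have hcoord : ∀ (κ : ℕ) (i : Fin 8), (fun u : Fin 8 → ℕ =>
      κ * (2 * (2 * M * u 5).size - u 7) * u 4 + u 7 * l * u i) ∈ 𝓕 8 := fun κ i =>
    h.add (h.mul (h.mul (h.const _ κ) (h.sub (h.mul (h.const _ 2) (hsize 5)) (h.proj _ 7)))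
      (h.proj _ 4)) (h.mul (h.mul (h.proj _ 7) (h.const _ l)) (h.proj _ i))
  -- The node `c + (j / 2N)(a - c)` over the common denominator `2 * N * l * q`, with `e`, `m`, `j`
  -- in positions 5, 6, 7; the last entry is the precision demanded of the samples.
  let A : Fin 6 → (Fin 8 → ℕ) → ℕ := ![
    fun u => γ * (2 * (2 * M * u 5).size - u 7) * u 4 + u 7 * l * u 0,
    fun u => γ' * (2 * (2 * M * u 5).size - u 7) * u 4 + u 7 * l * u 1,
    fun u => δ * (2 * (2 * M * u 5).size - u 7) * u 4 + u 7 * l * u 2,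
    fun u => δ' * (2 * (2 * M * u 5).size - u 7) * u 4 + u 7 * l * u 3,
    fun u => 2 * (2 * M * u 5).size * l * u 4,
    fun u => 2 * u 5 * (4 * M * u 5) ^ 4]
  have hA : ∀ i, A i ∈ 𝓕 8 := by
    intro i
    fin_cases i
    · exact hcoord γ 0
    · exact hcoord γ' 1
    · exact hcoord δ 2
    · exact hcoord δ' 3
    · exact h.mul (h.mul (h.mul (h.const _ 2) (hsize 5)) (h.const _ l)) (h.proj _ 4)
    · exact h.mul (h.mul (h.const _ 2) (h.proj _ 5))
        (h.pow (h.mul (h.const _ (4 * M)) (h.proj _ 5)) 4)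
  have hG₂ := h.gaussian_mul (h.gaussian_mul (h.gaussian_neg_one_pow
    (h.sub (h.proj 8 6) (h.proj 8 7))) (h.gaussian_natCast hf₂)) (h.gaussian_comp hg hA)
  have hG₁ := h.gaussian_mul (h.gaussian_natCast hf₁)
    (h.gaussian_sum_snoc hG₂ (h.add_one (h.proj 7 6)))
  refine ⟨_, h.gaussian_sum_snoc hG₁ (h.add_one (hsize 5)), ?_⟩
  rintro s s' t t' q e N he hM rfl
  have hpos : 0 < (2 * M * e).size := Nat.size_pos.2 (by positivity)
  have hpow : 2 ^ (2 * (2 * M * e).size) ≤ (4 * M * e) ^ 2 := by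
    rw [mul_comm, pow_mul]
    refine Nat.pow_le_pow_left ?_ 2
    obtain ⟨a, ha⟩ := Nat.exists_eq_succ_of_ne_zero hpos.ne'
    have : 2 ^ a ≤ 2 * M * e := Nat.lt_size.1 (by omega)
    rw [ha, pow_succ]
    linarith
  refine sum_congr rfl (fun m hm => ?_)
  have hm' : m ≤ (2 * M * e).size := Nat.lt_succ_iff.1 (mem_range.1 hm)
  have e₁ := hf₁' (Fin.snoc ![s, s', t, t', q, e] m) hpow
  refine congrArg₂ _ (congrArg _ e₁) ?_
  refine sum_congr rfl (fun j _ => ?_)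
  have e₂ := hf₂' (Fin.snoc (Fin.snoc ![s, s', t, t', q, e] m : Fin 7 → ℕ) j)
    (le_trans (Nat.pow_le_pow_right (by norm_num) (hm'.trans (by omega))) hpow)
  refine congrArg₂ _ (congrArg₂ _ rfl (congrArg _ e₂)) (congrArg g ?_)
  funext i
  fin_cases i <;> rfl

-- Half of the allowed error `1 / e` goes to truncating Newton's formula, half to the errors of the
-- samples. All samples share the denominator `k e'`, so the result is again a Gaussian integer over
-- a denominator depending on `e` alone.
open Finset in
theorem approx_closedBall_two_mul {F : ℂ → ℂ} {γ γ' δ δ' l : ℕ} (hl : 0 < l) {r R : ℝ}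
    (hr : 0 < r) (hR : 64 * r < R)
    (hF : DifferentiableOn ℂ F (Metric.closedBall (ratPoint γ γ' δ δ' l) R))
    (hA : 𝓕.Approx (Metric.closedBall (ratPoint γ γ' δ δ' l) r) F) :
    𝓕.Approx (Metric.closedBall (ratPoint γ γ' δ δ' l) (2 * r)) F := by
  set c := ratPoint γ γ' δ δ' l with hc
  obtain ⟨d, k, g, hd, hk, hd0, hk0, hg, H⟩ := hA
  obtain ⟨M, hM, hMb⟩ := exists_extrapolation_bound hr hR hF
  obtain ⟨G, hG, hGe⟩ := h.exists_gaussian_newton hg γ γ' δ δ' l M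
  have hprec : (fun v : Fin 1 → ℕ => 2 * v 0 * (4 * M * v 0) ^ 4) ∈ 𝓕 1 :=
    h.mul (h.mul (h.const _ 2) (h.proj 1 0)) (h.pow (h.mul (h.const _ (4 * M)) (h.proj 1 0)) 4)
  refine ⟨fun e => d (2 * e * (4 * M * e) ^ 4), fun e => k (2 * e * (4 * M * e) ^ 4), G,
    h.comp₁ hd hprec, h.comp₁ hk hprec, fun e => hd0 _, fun e => hk0 _, hG, ?_⟩
  intro s s' t t' q e hq he x hx hxa
  obtain ⟨N, hN⟩ : ∃ N, (2 * M * e).size = N := ⟨_, rfl⟩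
  rw [hGe s s' t t' q e N he hM hN]
  set e' := 2 * e * (4 * M * e) ^ 4 with he'
  have he'0 : 0 < e' := by positivity
  have hN0 : 0 < N := hN ▸ Nat.size_pos.2 (by positivity)
  have hlow : 2 * M * e ≤ 2 ^ N := hN ▸ (Nat.lt_size_self _).le
  have hhigh : 2 ^ N ≤ 4 * M * e := by
    obtain ⟨a, ha⟩ := Nat.exists_eq_succ_of_ne_zero hN0.ne'
    have : 2 ^ a ≤ 2 * M * e := Nat.lt_size.1 (by omega)
    rw [ha, pow_succ]
    linarith
  have hNC : (N : ℂ) ≠ 0 := by exact_mod_cast hN0.ne'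
  have hNR : (0 : ℝ) < N := by exact_mod_cast hN0
  have hlC : (l : ℂ) ≠ 0 := by exact_mod_cast hl.ne'
  have hqC : (q : ℂ) ≠ 0 := by exact_mod_cast hq.ne'
  have heR : (0 : ℝ) < e := by exact_mod_cast he
  have hMR : (0 : ℝ) < M := by exact_mod_cast hM
  have he'R : (0 : ℝ) < e' := by exact_mod_cast he'0
  set y : ℕ → ℂ := fun j => c + (j / (2 * N)) * (x - c) with hy
  set w : ℕ → ℂ := fun j => g ![γ * (2 * N - j) * q + j * l * s, γ' * (2 * N - j) * q + j * l * s',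
    δ * (2 * N - j) * q + j * l * t, δ' * (2 * N - j) * q + j * l * t',
    2 * N * l * q, e'] with hw
  -- Since `j / (2 * N) ≤ 1 / 2`, the nodes lie in the disc of radius `r`, and the error of the
  -- rational argument does not grow.
  have hnode : ∀ j ≤ N, ‖F (y j) - w j / k e'‖ ≤ 1 / e' := by
    intro j hj
    have hratio : ‖(j : ℂ) / (2 * N)‖ ≤ 1 / 2 := by
      have : ‖(j : ℂ) / (2 * N)‖ = (j : ℝ) / (2 * N) := by simp
      rw [this, div_le_div_iff₀ (by positivity) (by norm_num)]
      have : (j : ℝ) ≤ N := by exact_mod_cast hj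
      linarith
    refine H _ _ _ _ _ e' (by positivity) he'0 (y j) ?_ ?_
    · rw [mem_closedBall_iff_norm] at hx ⊢
      simp only [hy, add_sub_cancel_left]
      rw [norm_mul]
      calc ‖(j : ℂ) / (2 * N)‖ * ‖x - c‖ ≤ 1 / 2 * (2 * r) := by gcongr
        _ = r := by ring
    · have hpt : ratPoint (γ * (2 * N - j) * q + j * l * s) (γ' * (2 * N - j) * q + j * l * s')
          (δ * (2 * N - j) * q + j * l * t) (δ' * (2 * N - j) * q + j * l * t') (2 * N * l * q) =
          c + (j / (2 * N)) * (ratPoint s s' t t' q - c) := by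
        rw [hc]
        simp only [ratPoint]
        push_cast [Nat.cast_sub (show j ≤ 2 * N by omega)]
        field_simp
        ring
      rw [hpt]
      have : y j - (c + (j / (2 * N)) * (ratPoint s s' t t' q - c)) =
          (j / (2 * N)) * (x - ratPoint s s' t t' q) := by
        simp only [hy]
        ring
      rw [this, norm_mul]
      calc ‖(j : ℂ) / (2 * N)‖ * ‖x - ratPoint s s' t t' q‖ ≤ 1 * (1 / d e') := by
            gcongr
            linarith
        _ = 1 / d e' := one_mul _
  have hsum : ‖∑ m ∈ range (N + 1), ((2 * N).choose m : ℂ) * ∑ j ∈ range (m + 1),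
      ((-1) ^ (m - j) * (m.choose j : ℂ)) * (F (y j) - w j / k e')‖ ≤ 3 ^ (2 * N) * (1 / e') := by
    refine (norm_sum_le _ _).trans ?_
    have h1 : ∀ m ∈ range (N + 1), ‖((2 * N).choose m : ℂ) * ∑ j ∈ range (m + 1),
        ((-1) ^ (m - j) * (m.choose j : ℂ)) * (F (y j) - w j / k e')‖ ≤
        2 ^ m * ((2 * N).choose m : ℝ) * (1 / e') := by
      intro m hm
      rw [mem_range] at hm
      rw [norm_mul, Complex.norm_natCast, mul_comm (2 ^ m), mul_assoc]
      refine mul_le_mul_of_nonneg_left ((norm_sum_le _ _).trans ?_) (by positivity)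
      have h2 : ∀ j ∈ range (m + 1), ‖((-1) ^ (m - j) * (m.choose j : ℂ)) *
          (F (y j) - w j / k e')‖ ≤ (m.choose j : ℝ) * (1 / e') := by
        intro j hj
        rw [mem_range] at hj
        rw [norm_mul, norm_mul, norm_pow, norm_neg, norm_one, one_pow, one_mul,
          Complex.norm_natCast]
        gcongr
        exact hnode j (by omega)
      refine (sum_le_sum h2).trans_eq ?_
      rw [← sum_mul, ← Nat.cast_sum, Nat.sum_range_choose]
      push_cast
      rfl
    refine (sum_le_sum h1).trans ?_
    refine (sum_le_sum_of_subset_of_nonneg (t := range (2 * N + 1)) (range_mono (by omega))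
      (fun m _ _ => by positivity)).trans_eq ?_
    rw [← sum_mul]
    have := add_pow (2 : ℝ) 1 (2 * N)
    norm_num at this
    rw [this]
  have hdecomp : F x - (∑ m ∈ range (N + 1), ((2 * N).choose m : ℂ) * ∑ j ∈ range (m + 1),
      ((-1) ^ (m - j) * (m.choose j : ℂ)) * w j) / k e' =
      (F x - ∑ m ∈ range (N + 1), ((2 * N).choose m : ℂ) * ∑ j ∈ range (m + 1),
        ((-1) ^ (m - j) * (m.choose j : ℂ)) * F (y j)) +
      ∑ m ∈ range (N + 1), ((2 * N).choose m : ℂ) * ∑ j ∈ range (m + 1),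
        ((-1) ^ (m - j) * (m.choose j : ℂ)) * (F (y j) - w j / k e') := by
    simp only [mul_sub, sum_sub_distrib, sum_div, mul_sum, mul_div_assoc]
    ring
  rw [hdecomp]
  refine (norm_add_le _ _).trans ((add_le_add (hMb x hx N hN0) hsum).trans ?_)
  have b1 : (M : ℝ) / 2 ^ N ≤ 1 / (2 * e) := by
    rw [div_le_div_iff₀ (by positivity) (by positivity)]
    have : ((2 * M * e : ℕ) : ℝ) ≤ ((2 ^ N : ℕ) : ℝ) := by exact_mod_cast hlow
    push_cast at this
    linarith
  -- Because `9 ≤ 2 ^ 4`, the amplification is at most `(2 ^ N) ^ 4 ≤ (4 * M * e) ^ 4`, exactly the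
  -- factor built into `e'`.
  have b2 : (3 : ℝ) ^ (2 * N) * (1 / e') ≤ 1 / (2 * e) := by
    have h9 : (3 : ℝ) ^ (2 * N) ≤ (4 * M * e) ^ 4 := by
      calc (3 : ℝ) ^ (2 * N) = (3 ^ 2) ^ N := by rw [pow_mul]
        _ ≤ (2 ^ 4) ^ N := by gcongr; norm_num
        _ = (2 ^ N) ^ 4 := by rw [← pow_mul, ← pow_mul, mul_comm]
        _ ≤ (4 * M * e) ^ 4 := by
          gcongr
          exact_mod_cast hhigh
    have he'' : (e' : ℝ) = 2 * e * (4 * M * e) ^ 4 := by rw [he']; push_cast; ring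
    rw [he'', mul_one_div, div_le_div_iff₀ (by positivity) (by positivity)]
    calc (3 : ℝ) ^ (2 * N) * (2 * e) ≤ (4 * M * e) ^ 4 * (2 * e) := by gcongr
      _ = 1 * (2 * e * (4 * M * e) ^ 4) := by ring
  calc (M : ℝ) / 2 ^ N + 3 ^ (2 * N) * (1 / e') ≤ 1 / (2 * e) + 1 / (2 * e) := add_le_add b1 b2
    _ = 1 / e := by field_simp; norm_num

end FunClass.IsGood

/-! ### Passing between lowest terms and common denominators -/

/-- The integer part of the product of `r` with `E` if `r` is non-negative, and zero otherwise. -/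
def scaledFloor (r : ℚ) (E : ℕ) : ℕ := r.num.toNat * E / r.den

/-- Each floor loses at most `1`, and the two losses have opposite signs. -/
theorem abs_sub_scaledFloor_le (r : ℚ) {E : ℕ} (hE : 0 < E) :
    |(r : ℝ) - ((scaledFloor r E : ℝ) - scaledFloor (-r) E) / E| ≤ 1 / E := by
  have hER : (0 : ℝ) < E := by exact_mod_cast hE
  have hd : (0 : ℝ) < r.den := by exact_mod_cast r.den_pos
  have hfl : ∀ a b : ℕ, 0 < b → ((a / b : ℕ) : ℝ) ≤ (a : ℝ) / b ∧ (a : ℝ) / b ≤ (a / b : ℕ) + 1 := by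
    intro a b hb
    have hbR : (0 : ℝ) < b := by exact_mod_cast hb
    refine ⟨Nat.cast_div_le, ?_⟩
    rw [div_le_iff₀ hbR]
    have := (Nat.lt_mul_div_succ a hb).le
    have h2 : ((a : ℕ) : ℝ) ≤ ((b * (a / b + 1) : ℕ) : ℝ) := by exact_mod_cast this
    push_cast at h2 ⊢
    linarith
  have hr : (r : ℝ) * E = ((r.num.toNat * E : ℕ) : ℝ) / r.den - (((-r.num).toNat * E : ℕ) : ℝ) / r.den := by
    have h1 : (r : ℝ) = (r.num : ℝ) / r.den := by exact_mod_cast (Rat.num_div_den r).symm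
    have h2 : (r.num : ℝ) = (r.num.toNat : ℝ) - ((-r.num).toNat : ℝ) := by
      exact_mod_cast (Int.toNat_sub_toNat_neg r.num).symm
    rw [h1, h2]
    push_cast
    ring
  have key : (r : ℝ) - ((scaledFloor r E : ℝ) - scaledFloor (-r) E) / E =
      ((r : ℝ) * E - ((scaledFloor r E : ℝ) - scaledFloor (-r) E)) / E := by
    field_simp
  rw [key, abs_div, abs_of_pos hER]
  refine div_le_div_of_nonneg_right ?_ hER.le
  rw [hr, scaledFloor, scaledFloor, Rat.num_neg_eq_neg_num, Rat.den_neg_eq_den]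
  obtain ⟨h1, h2⟩ := hfl (r.num.toNat * E) r.den r.den_pos
  obtain ⟨h3, h4⟩ := hfl ((-r.num).toNat * E) r.den r.den_pos
  rw [abs_le]
  constructor <;> linarith

/-- The floor is insensitive to cancelling common factors, so it can be read off an unreduced
fraction; `c = 0` agrees through division by zero. -/
theorem scaledFloor_sub_div (a b c E : ℕ) :
    scaledFloor (((a : ℚ) - b) / c) E = (a - b) * E / c := by
  set r : ℚ := ((a : ℚ) - b) / c with hr
  rcases Nat.eq_zero_or_pos c with rfl | hc
  · simp [hr, scaledFloor]
  have hcQ : (0 : ℚ) < c := by exact_mod_cast hc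
  rcases le_total a b with hab | hab
  · have hle : r ≤ 0 := div_nonpos_of_nonpos_of_nonneg
      (sub_nonpos.2 (by exact_mod_cast hab)) hcQ.le
    have : r.num ≤ 0 := Rat.num_nonpos.2 hle
    simp [scaledFloor, Int.toNat_of_nonpos this, Nat.sub_eq_zero_of_le hab]
  · have hge : 0 ≤ r := div_nonneg (sub_nonneg.2 (by exact_mod_cast hab)) hcQ.le
    have hnum : 0 ≤ r.num := Rat.num_nonneg.2 hge
    have hcross : r.num.toNat * c = (a - b) * r.den := by
      have h1 : (r.num : ℚ) = r * r.den := (Rat.mul_den_eq_num r).symm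
      have h2 : r * c = (a : ℚ) - b := div_mul_cancel₀ _ hcQ.ne'
      have h3 : ((r.num.toNat * c : ℕ) : ℚ) = (((a - b) * r.den : ℕ) : ℚ) := by
        have h4 : ((r.num.toNat : ℕ) : ℚ) = (r.num : ℚ) := by
          exact_mod_cast Int.toNat_of_nonneg hnum
        push_cast [Nat.cast_sub hab]
        rw [h4, h1, ← h2]
        ring
      exact_mod_cast h3
    rw [scaledFloor, ← Nat.mul_div_mul_right _ _ hc, mul_right_comm, hcross,
      mul_right_comm, mul_comm r.den c, Nat.mul_div_mul_right _ _ r.den_pos]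

/-- The retraction of `ℚ` demands lowest terms; the gcd is taken with `|a - b|`, written as a sum of
truncated differences. -/
theorem num_toNat_sub_div (a b : ℕ) {c : ℕ} (hc : 0 < c) :
    (((a : ℚ) - b) / c).num.toNat = (a - b) / Nat.gcd ((a - b) + (b - a)) c ∧
    (-(((a : ℚ) - b) / c).num).toNat = (b - a) / Nat.gcd ((a - b) + (b - a)) c ∧
    (((a : ℚ) - b) / c).den = c / Nat.gcd ((a - b) + (b - a)) c := by
  have key : ∀ u : ℕ, ((u : ℚ) / c).num = (u / Nat.gcd u c : ℕ) ∧
      ((u : ℚ) / c).den = c / Nat.gcd u c := by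
    intro u
    have hD : 0 < Nat.gcd u c := Nat.gcd_pos_of_pos_right _ hc
    obtain ⟨x, hx⟩ := Nat.gcd_dvd_left u c
    obtain ⟨y, hy⟩ := Nat.gcd_dvd_right u c
    have hcop := Nat.coprime_div_gcd_div_gcd hD
    have hxe : u / Nat.gcd u c = x := Nat.div_eq_of_eq_mul_right hD hx
    have hye : c / Nat.gcd u c = y := Nat.div_eq_of_eq_mul_right hD hy
    rw [hxe, hye] at hcop ⊢
    have hy0 : 0 < y := Nat.pos_of_ne_zero (fun h0 => by rw [h0, mul_zero] at hy; omega)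
    have heq : (u : ℚ) / c = ((x : ℤ) : ℚ) / ((y : ℤ) : ℚ) := by
      have hcross : u * y = x * c := by
        calc u * y = Nat.gcd u c * x * y := by rw [← hx]
          _ = x * (Nat.gcd u c * y) := by ring
          _ = x * c := by rw [← hy]
      push_cast
      rw [div_eq_div_iff (by exact_mod_cast hc.ne') (by exact_mod_cast hy0.ne')]
      exact_mod_cast hcross
    have hy0' : (0 : ℤ) < y := by exact_mod_cast hy0
    refine ⟨?_, ?_⟩
    · rw [heq]
      exact Rat.num_div_eq_of_coprime hy0' (by simpa using hcop)
    · have := Rat.den_div_eq_of_coprime (a := x) (b := y) hy0' (by simpa using hcop)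
      rw [heq]
      exact_mod_cast this
  rcases le_total b a with hab | hab
  · have h1 : (a : ℚ) - b = ((a - b : ℕ) : ℚ) := by push_cast [Nat.cast_sub hab]; ring
    rw [h1, Nat.sub_eq_zero_of_le hab, add_zero, (key _).1, (key _).2]
    exact ⟨Int.toNat_natCast _, by
      rw [Int.toNat_of_nonpos (neg_nonpos.2 (Int.natCast_nonneg _)), Nat.zero_div], rfl⟩
  · have h1 : ((a : ℚ) - b) / c = -(((b - a : ℕ) : ℚ) / c) := by
      push_cast [Nat.cast_sub hab]
      ring
    rw [h1, Nat.sub_eq_zero_of_le hab, zero_add, Rat.num_neg_eq_neg_num, Rat.den_neg_eq_den,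
      (key _).1, (key _).2, neg_neg]
    exact ⟨by rw [Int.toNat_of_nonpos (neg_nonpos.2 (Int.natCast_nonneg _)), Nat.zero_div],
      Int.toNat_natCast _, rfl⟩

theorem ratPow_prod_nat_π (v : Fin 7 → ℕ) :
    ((Retract.rat.pow 2).prod Retract.nat).π v =
      (![((v 0 : ℚ) - v 1) / v 2, ((v 3 : ℚ) - v 4) / v 5], v 6) := by
  refine Prod.ext ?_ rfl
  funext i
  have h : ∀ a b c : ℕ, (((a : ℤ) - (b : ℤ) : ℤ) : ℚ) / (c : ℚ) = ((a : ℚ) - b) / c := by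
    intro a b c
    push_cast
    rfl
  fin_cases i
  · exact h (v 0) (v 1) (v 2)
  · exact h (v 3) (v 4) (v 5)

theorem FunClass.has_rat_pow_iff {𝓕 : FunClass} {X : Type} {N : ℕ} (c : Retract X)
    (f : X → Fin N → ℚ) :
    𝓕.Has c (Retract.rat.pow N) f ↔ ∀ i,
      (fun v => (f (c.π v) i).num.toNat) ∈ 𝓕 c.dim ∧
      (fun v => (-(f (c.π v) i).num).toNat) ∈ 𝓕 c.dim ∧
      (fun v => (f (c.π v) i).den) ∈ 𝓕 c.dim := by
  have hcomp : ∀ (i : Fin N) (k : Fin 3) (v : Fin c.dim → ℕ),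
      (Retract.rat.pow N).ι (f (c.π v)) (finProdFinEquiv (i, k)) =
        ![(f (c.π v) i).num.toNat, (-(f (c.π v) i).num).toNat, (f (c.π v) i).den] k := by
    intro i k v
    have : (Retract.rat.pow N).ι (f (c.π v)) (finProdFinEquiv (i, k)) =
        Retract.rat.ι (f (c.π v) i) k := by
      change Retract.rat.ι (f (c.π v) (finProdFinEquiv.symm (finProdFinEquiv (i, k))).1)
        (finProdFinEquiv.symm (finProdFinEquiv (i, k))).2 = _
      rw [Equiv.symm_apply_apply]
    rw [this]
    fin_cases k <;> rfl
  constructor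
  · intro hf i
    have key : ∀ k : Fin 3, (fun v => ![(f (c.π v) i).num.toNat, (-(f (c.π v) i).num).toNat,
        (f (c.π v) i).den] k) ∈ 𝓕 c.dim := fun k => by
      simpa only [hcomp] using hf (finProdFinEquiv (i, k))
    exact ⟨key 0, key 1, key 2⟩
  · intro hf j
    obtain ⟨⟨i, k⟩, rfl⟩ := finProdFinEquiv.surjective (show Fin (N * 3) from j)
    obtain ⟨h0, h1, h2⟩ := hf i
    have : (fun v => ![(f (c.π v) i).num.toNat, (-(f (c.π v) i).num).toNat,
        (f (c.π v) i).den] k) ∈ 𝓕 c.dim := by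
      fin_cases k
      · exact h0
      · exact h1
      · exact h2
    simp only [← hcomp] at this
    exact this

namespace FunClass.IsGood

variable {𝓕 : FunClass} (h : 𝓕.IsGood) {n : ℕ}

include h

theorem scaledFloor_mem {a b c E : (Fin n → ℕ) → ℕ} (ha : a ∈ 𝓕 n) (hb : b ∈ 𝓕 n) (hc : c ∈ 𝓕 n)
    (hE : E ∈ 𝓕 n) : (fun v => scaledFloor (((a v : ℚ) - b v) / c v) (E v)) ∈ 𝓕 n := by
  simp only [scaledFloor_sub_div]
  exact h.div (h.mul (h.sub ha hb) hE) hc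

theorem num_den_mem {a b c : (Fin n → ℕ) → ℕ} (ha : a ∈ 𝓕 n) (hb : b ∈ 𝓕 n) (hc : c ∈ 𝓕 n)
    (hc0 : ∀ v, 0 < c v) :
    (fun v => (((a v : ℚ) - b v) / c v).num.toNat) ∈ 𝓕 n ∧
    (fun v => (-(((a v : ℚ) - b v) / c v).num).toNat) ∈ 𝓕 n ∧
    (fun v => (((a v : ℚ) - b v) / c v).den) ∈ 𝓕 n := by
  have hD := h.gcd (h.add (h.sub ha hb) (h.sub hb ha)) hc
  refine ⟨?_, ?_, ?_⟩
  · simp only [(num_toNat_sub_div _ _ (hc0 _)).1]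
    exact h.div (h.sub ha hb) hD
  · simp only [(num_toNat_sub_div _ _ (hc0 _)).2.1]
    exact h.div (h.sub hb ha) hD
  · simp only [(num_toNat_sub_div _ _ (hc0 _)).2.2]
    exact h.div hc hD

theorem hasOnCompact_of_approx {F : ℂ → ℂ} {K : Set ℂ} (hA : 𝓕.Approx K F) :
    𝓕.HasOnCompact (planeEquiv '' K) (realForm F) := by
  obtain ⟨d, k, g, hd, hk, hd0, hk0, ⟨p, hp, p', hp', q, hq, q', hq', hg⟩, H⟩ := hA
  -- Both coordinates are rounded to the denominator `4 * d (e + 1)`. Two coordinates, each off by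
  -- the distance to `a` and by rounding, give a total of `1 / d (e + 1)`. Precision `e + 1` yields
  -- the strict inequality.
  let A : (Fin 2 → ℚ) × ℕ → Fin 6 → ℕ := fun x =>
    ![scaledFloor (x.1 0) (4 * d (x.2 + 1)), scaledFloor (-x.1 0) (4 * d (x.2 + 1)),
      scaledFloor (x.1 1) (4 * d (x.2 + 1)), scaledFloor (-x.1 1) (4 * d (x.2 + 1)),
      4 * d (x.2 + 1), x.2 + 1]
  let f : (Fin 2 → ℚ) × ℕ → (Fin 2 → ℚ) := fun x =>
    ![((p (A x) : ℚ) - p' (A x)) / k (x.2 + 1), ((q (A x) : ℚ) - q' (A x)) / k (x.2 + 1)]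
  have hQ : (fun v : Fin 7 → ℕ => 4 * d (v 6 + 1)) ∈ 𝓕 7 :=
    h.mul (h.const _ 4) (h.comp₁ hd (h.add_one (h.proj 7 6)))
  have hAmem : ∀ i, (fun v : Fin 7 → ℕ =>
      A (![((v 0 : ℚ) - v 1) / v 2, ((v 3 : ℚ) - v 4) / v 5], v 6) i) ∈ 𝓕 7 := by
    have hneg : ∀ a b c : ℕ, -(((a : ℚ) - b) / c) = ((b : ℚ) - a) / c := fun a b c => by ring
    intro i
    fin_cases i
    · exact h.scaledFloor_mem (h.proj 7 0) (h.proj 7 1) (h.proj 7 2) hQ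
    · change (fun v : Fin 7 → ℕ =>
        scaledFloor (-(((v 0 : ℚ) - v 1) / v 2)) (4 * d (v 6 + 1))) ∈ 𝓕 7
      simp only [hneg]
      exact h.scaledFloor_mem (h.proj 7 1) (h.proj 7 0) (h.proj 7 2) hQ
    · exact h.scaledFloor_mem (h.proj 7 3) (h.proj 7 4) (h.proj 7 5) hQ
    · change (fun v : Fin 7 → ℕ =>
        scaledFloor (-(((v 3 : ℚ) - v 4) / v 5)) (4 * d (v 6 + 1))) ∈ 𝓕 7
      simp only [hneg]
      exact h.scaledFloor_mem (h.proj 7 4) (h.proj 7 3) (h.proj 7 5) hQ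
    · exact hQ
    · exact h.add_one (h.proj 7 6)
  have hcompA : ∀ b ∈ 𝓕 6, (fun v : Fin 7 → ℕ =>
      b (A (![((v 0 : ℚ) - v 1) / v 2, ((v 3 : ℚ) - v 4) / v 5], v 6))) ∈ 𝓕 7 :=
    fun b hb => h.comp 6 7 b _ hb hAmem
  have hkmem : (fun v : Fin 7 → ℕ => k (v 6 + 1)) ∈ 𝓕 7 := h.comp₁ hk (h.add_one (h.proj 7 6))
  -- Partial sums make the modulus strictly increasing while staying in the class.
  refine ⟨fun e => ∑ i ∈ Finset.range (e + 1), 4 * d (i + 1), f, ?_, ?_, ?_, ?_⟩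
  · refine strictMono_nat_of_lt_succ (fun e => ?_)
    rw [Finset.sum_range_succ _ (e + 1)]
    have := hd0 (e + 1 + 1)
    omega
  · intro j
    exact h.sum (f := fun (_ : Fin 1 → ℕ) i => 4 * d (i + 1))
      (h.mul (h.const _ 4) (h.comp₁ hd (h.add_one h.last))) (h.add_one (h.proj 1 0))
  · rw [has_rat_pow_iff]
    have hπ := ratPow_prod_nat_π
    intro i
    change (fun v : Fin 7 → ℕ => (f (((Retract.rat.pow 2).prod Retract.nat).π v) i).num.toNat) ∈ 𝓕 7 ∧
      (fun v : Fin 7 → ℕ => (-(f (((Retract.rat.pow 2).prod Retract.nat).π v) i).num).toNat) ∈ 𝓕 7 ∧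
      (fun v : Fin 7 → ℕ => (f (((Retract.rat.pow 2).prod Retract.nat).π v) i).den) ∈ 𝓕 7
    simp only [hπ]
    fin_cases i
    · exact h.num_den_mem (hcompA p hp) (hcompA p' hp') hkmem (fun v => hk0 _)
    · exact h.num_den_mem (hcompA q hq) (hcompA q' hq') hkmem (fun v => hk0 _)
  · rintro e he a _ ⟨z, hz, rfl⟩ hza
    have hd4 : 4 * d (e + 1) ≤ ∑ i ∈ Finset.range (e + 1), 4 * d (i + 1) :=
      Finset.single_le_sum (f := fun i => 4 * d (i + 1)) (fun _ _ => Nat.zero_le _)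
        (Finset.mem_range.2 (Nat.lt_succ_self e))
    have hdR : (0 : ℝ) < d (e + 1) := by exact_mod_cast hd0 (e + 1)
    have hza' : ‖planeEquiv z - fun i => (a i : ℝ)‖ < 1 / (4 * d (e + 1)) := by
      refine hza.trans_le (one_div_le_one_div_of_le (by positivity) ?_)
      exact_mod_cast hd4
    have hcoord := (pi_norm_lt_iff (by positivity)).1 hza'
    have hre : |z.re - a 0| < 1 / (4 * d (e + 1)) := hcoord 0
    have him : |z.im - a 1| < 1 / (4 * d (e + 1)) := hcoord 1
    have hQ0 : 0 < 4 * d (e + 1) := by have := hd0 (e + 1); omega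
    have hre' := abs_sub_scaledFloor_le (a 0) hQ0
    have him' := abs_sub_scaledFloor_le (a 1) hQ0
    have hzp : ‖z - ratPoint (A (a, e) 0) (A (a, e) 1) (A (a, e) 2) (A (a, e) 3)
        (4 * d (e + 1))‖ ≤ 1 / d (e + 1) := by
      refine (Complex.norm_le_abs_re_add_abs_im _).trans ?_
      have e1 : (ratPoint (A (a, e) 0) (A (a, e) 1) (A (a, e) 2) (A (a, e) 3)
          (4 * d (e + 1))) = (((((scaledFloor (a 0) (4 * d (e + 1)) : ℝ) -
            scaledFloor (-a 0) (4 * d (e + 1))) / (4 * d (e + 1) : ℕ) : ℝ)) : ℂ) +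
            (((((scaledFloor (a 1) (4 * d (e + 1)) : ℝ) -
            scaledFloor (-a 1) (4 * d (e + 1))) / (4 * d (e + 1) : ℕ) : ℝ)) : ℂ) * Complex.I := by
        simp only [ratPoint]
        push_cast
        rw [add_div, mul_div_right_comm]
        rfl
      rw [e1]
      simp only [Complex.sub_re, Complex.sub_im, Complex.add_re, Complex.add_im, Complex.ofReal_re,
        Complex.ofReal_im, Complex.re_ofReal_mul, Complex.im_ofReal_mul, Complex.I_re, Complex.I_im,
        mul_zero, mul_one, add_zero, zero_add]
      have t1 := abs_sub_le z.re (a 0) (((scaledFloor (a 0) (4 * d (e + 1)) : ℝ) -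
            scaledFloor (-a 0) (4 * d (e + 1))) / (4 * d (e + 1) : ℕ))
      have t2 := abs_sub_le z.im (a 1) (((scaledFloor (a 1) (4 * d (e + 1)) : ℝ) -
            scaledFloor (-a 1) (4 * d (e + 1))) / (4 * d (e + 1) : ℕ))
      have hval : (1 : ℝ) / d (e + 1) = 4 * (1 / (4 * d (e + 1))) := by field_simp
      have hcast : (1 : ℝ) / ((4 * d (e + 1) : ℕ) : ℝ) = 1 / (4 * d (e + 1)) := by push_cast; rfl
      rw [hcast] at hre' him'
      linarith
    have hmain := H _ _ _ _ _ (e + 1) hQ0 (Nat.succ_pos e) z hz hzp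
    have hvec : (![A (a, e) 0, A (a, e) 1, A (a, e) 2, A (a, e) 3, 4 * d (e + 1), e + 1] :
        Fin 6 → ℕ) = A (a, e) := by
      funext i
      fin_cases i <;> rfl
    rw [hvec, hg] at hmain
    have hlt : (1 : ℝ) / (e + 1 : ℕ) < 1 / e := by
      refine one_div_lt_one_div_of_lt (by exact_mod_cast he) ?_
      exact_mod_cast Nat.lt_succ_self e
    have e2 : (((p (A (a, e)) : ℂ) - p' (A (a, e))) +
        ((q (A (a, e)) : ℂ) - q' (A (a, e))) * Complex.I) / k (e + 1) =
        ((f (a, e) 0 : ℝ) : ℂ) + ((f (a, e) 1 : ℝ) : ℂ) * Complex.I := by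
      simp only [f, Matrix.cons_val_zero, Matrix.cons_val_one]
      push_cast
      rw [add_div, mul_div_right_comm]
    rw [e2] at hmain
    rw [pi_norm_lt_iff (by positivity)]
    have h0 := (Complex.abs_re_le_norm _).trans_lt (hmain.trans_lt hlt)
    have h1 := (Complex.abs_im_le_norm _).trans_lt (hmain.trans_lt hlt)
    simp only [Complex.sub_re, Complex.sub_im, Complex.add_re, Complex.add_im, Complex.ofReal_re,
        Complex.ofReal_im, Complex.re_ofReal_mul, Complex.im_ofReal_mul, Complex.I_re, Complex.I_im,
        mul_zero, mul_one, add_zero, zero_add] at h0 h1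
    intro i
    fin_cases i
    · exact h0
    · exact h1

end FunClass.IsGood

/-! ### Gluing discs and the start from an open set -/

theorem exists_norm_sub_ratPoint_lt (z : ℂ) {ε : ℝ} (hε : 0 < ε) :
    ∃ s s' t t' q : ℕ, 0 < q ∧ ‖z - ratPoint s s' t t' q‖ < ε := by
  obtain ⟨N, hN⟩ := exists_nat_gt (2 / ε)
  have hNR : (0 : ℝ) < N := lt_trans (by positivity) hN
  have hfl : ∀ u : ℝ, |u - ((⌊u * N⌋.toNat : ℝ) - (-⌊u * N⌋).toNat) / N| ≤ 1 / N := by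
    intro u
    have h1 : ((⌊u * N⌋.toNat : ℝ) - (-⌊u * N⌋).toNat) = (⌊u * N⌋ : ℝ) := by
      exact_mod_cast Int.toNat_sub_toNat_neg ⌊u * N⌋
    have h2 : u - (⌊u * N⌋ : ℝ) / N = (u * N - ⌊u * N⌋) / N := by field_simp
    rw [h1, h2, abs_div, abs_of_pos hNR]
    refine div_le_div_of_nonneg_right ?_ hNR.le
    rw [abs_le]
    constructor
    · linarith [Int.floor_le (u * N)]
    · linarith [Int.lt_floor_add_one (u * N)]
  refine ⟨⌊z.re * N⌋.toNat, (-⌊z.re * N⌋).toNat, ⌊z.im * N⌋.toNat, (-⌊z.im * N⌋).toNat, N,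
    by exact_mod_cast hNR, ?_⟩
  have e1 : ratPoint ⌊z.re * N⌋.toNat (-⌊z.re * N⌋).toNat ⌊z.im * N⌋.toNat (-⌊z.im * N⌋).toNat N =
      ((((⌊z.re * N⌋.toNat : ℝ) - (-⌊z.re * N⌋).toNat) / N : ℝ) : ℂ) +
      ((((⌊z.im * N⌋.toNat : ℝ) - (-⌊z.im * N⌋).toNat) / N : ℝ) : ℂ) * Complex.I := by
    simp only [ratPoint]
    push_cast
    rw [add_div, mul_div_right_comm]
  have hN2 : 2 * (1 / N) < ε := by
    rw [div_lt_iff₀ hε] at hN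
    rw [mul_one_div, div_lt_iff₀ hNR]
    linarith
  refine (Complex.norm_le_abs_re_add_abs_im _).trans_lt (lt_of_le_of_lt ?_ hN2)
  rw [e1]
  simp only [Complex.sub_re, Complex.sub_im, Complex.add_re, Complex.add_im, Complex.ofReal_re,
    Complex.ofReal_im, Complex.re_ofReal_mul, Complex.im_ofReal_mul, Complex.I_re, Complex.I_im,
    mul_zero, mul_one, add_zero, zero_add]
  linarith [hfl z.re, hfl z.im]

namespace FunClass.IsGood

variable {𝓕 : FunClass} (h : 𝓕.IsGood)

include h

/-- Membership of `x` in a disc is undecidable from approximations, so the rational argument is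
tested against `3 / 2` of the radius. Passing puts `x` in the doubled disc; failing keeps `x` out of
the disc itself, hence in `S`. -/
theorem approx_union_closedBall {F : ℂ → ℂ} {S : Set ℂ} {γ γ' δ δ' l m r : ℕ} (hl : 0 < l)
    (hm : 0 < m) (hr : 0 < r) (hS : 𝓕.Approx S F)
    (hB : 𝓕.Approx (Metric.closedBall (ratPoint γ γ' δ δ' l) (2 * (m / r))) F) :
    𝓕.Approx (S ∪ Metric.closedBall (ratPoint γ γ' δ δ' l) (m / r)) F := by
  classical
  set c := ratPoint γ γ' δ δ' l with hc
  obtain ⟨d₁, k₁, g₁, hd₁, hk₁, hd₁0, hk₁0, hg₁, H₁⟩ := hS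
  obtain ⟨d₂, k₂, g₂, hd₂, hk₂, hd₂0, hk₂0, hg₂, H₂⟩ := hB
  -- `T` is `2 * r * l * q` times the difference of the rational argument and `c`, so that the test
  -- is on Gaussian integers.
  let T : (Fin 6 → ℕ) → ℂ := fun v => (2 * r : ℕ) *
    (l * ((((v 0 : ℕ) : ℂ) - v 1) + ((v 2 : ℂ) - v 3) * Complex.I) -
      v 4 * (((γ : ℂ) - γ') + ((δ : ℂ) - δ') * Complex.I))
  have hT : 𝓕.Gaussian T := by
    refine h.gaussian_mul (h.gaussian_natCast (h.const 6 (2 * r))) (h.gaussian_sub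
      (h.gaussian_mul (h.gaussian_natCast (h.const 6 l)) ?_)
      (h.gaussian_mul (h.gaussian_natCast (h.proj 6 4)) ?_))
    · exact ⟨_, h.proj 6 0, _, h.proj 6 1, _, h.proj 6 2, _, h.proj 6 3, fun _ => rfl⟩
    · exact ⟨_, h.const 6 γ, _, h.const 6 γ', _, h.const 6 δ, _, h.const 6 δ', fun _ => rfl⟩
  have hP : 𝓕.Pred (fun v : Fin 6 → ℕ => ‖T v‖ ≤ (3 * m * l * v 4 : ℕ)) :=
    h.pred_norm_le hT (h.mul (h.const 6 (3 * m * l)) (h.proj 6 4))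
  have hlR : (0 : ℝ) < l := by exact_mod_cast hl
  have hmR : (1 : ℝ) ≤ m := by exact_mod_cast hm
  have hrR : (0 : ℝ) < r := by exact_mod_cast hr
  have hTiff : ∀ s s' t t' q e : ℕ, 0 < q → (‖T ![s, s', t, t', q, e]‖ ≤ (3 * m * l * q : ℕ) ↔
      ‖ratPoint s s' t t' q - c‖ ≤ 3 / 2 * (m / r)) := by
    intro s s' t t' q e hq
    have hqR : (0 : ℝ) < q := by exact_mod_cast hq
    have hqC : (q : ℂ) ≠ 0 := by exact_mod_cast hq.ne'
    have hlC : (l : ℂ) ≠ 0 := by exact_mod_cast hl.ne'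
    have : T ![s, s', t, t', q, e] =
        ((2 * r * l * q : ℕ) : ℂ) * (ratPoint s s' t t' q - c) := by
      change ((2 * r : ℕ) : ℂ) *
        (l * (((s : ℂ) - s') + ((t : ℂ) - t') * Complex.I) -
          q * (((γ : ℂ) - γ') + ((δ : ℂ) - δ') * Complex.I)) = _
      rw [hc]
      simp only [ratPoint]
      push_cast
      field_simp
    rw [this, norm_mul, Complex.norm_natCast]
    push_cast
    have hpos : (0 : ℝ) < 2 * r * l * q := by positivity
    have e2 : (3 * m * l * q : ℝ) = 2 * r * l * q * (3 / 2 * (m / r)) := by field_simp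
    rw [e2, mul_le_mul_iff_right₀ hpos]
  -- The factor `2 * r` keeps the argument within half a radius of `x`; `k₁ e * k₂ e` serves both
  -- branches.
  refine ⟨fun e => d₁ e * d₂ e * (2 * r), fun e => k₁ e * k₂ e,
    fun v => if ‖T v‖ ≤ (3 * m * l * v 4 : ℕ) then g₂ v * k₁ (v 5) else g₁ v * k₂ (v 5),
    h.mul (h.mul hd₁ hd₂) (h.const 1 _), h.mul hk₁ hk₂,
    fun e => Nat.mul_pos (Nat.mul_pos (hd₁0 e) (hd₂0 e)) (by omega),
    fun e => Nat.mul_pos (hk₁0 e) (hk₂0 e),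
    h.gaussian_ite hP (h.gaussian_mul hg₂ (h.gaussian_natCast (h.comp₁ hk₁ (h.proj 6 5))))
      (h.gaussian_mul hg₁ (h.gaussian_natCast (h.comp₁ hk₂ (h.proj 6 5)))), ?_⟩
  intro s s' t t' q e hq he x hx hxa
  have hd₁R : (1 : ℝ) ≤ d₁ e := by exact_mod_cast hd₁0 e
  have hd₂R : (1 : ℝ) ≤ d₂ e := by exact_mod_cast hd₂0 e
  have hk₁C : (k₁ e : ℂ) ≠ 0 := by exact_mod_cast (hk₁0 e).ne'
  have hk₂C : (k₂ e : ℂ) ≠ 0 := by exact_mod_cast (hk₂0 e).ne'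
  have hr1 : (1 : ℝ) ≤ r := by exact_mod_cast hr
  push_cast at hxa
  have hxa₁ : ‖x - ratPoint s s' t t' q‖ ≤ 1 / d₁ e := by
    refine hxa.trans (one_div_le_one_div_of_le (by positivity) ?_)
    calc (d₁ e : ℝ) = d₁ e * 1 * 1 := by ring
      _ ≤ d₁ e * d₂ e * (2 * r) := by gcongr; linarith
  have hxa₂ : ‖x - ratPoint s s' t t' q‖ ≤ 1 / d₂ e := by
    refine hxa.trans (one_div_le_one_div_of_le (by positivity) ?_)
    calc (d₂ e : ℝ) = 1 * d₂ e * 1 := by ring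
      _ ≤ d₁ e * d₂ e * (2 * r) := by gcongr; linarith
  have hxa₃ : ‖x - ratPoint s s' t t' q‖ ≤ 1 / 2 * (m / r) := by
    calc ‖x - ratPoint s s' t t' q‖ ≤ 1 / (1 * 1 * (2 * r)) := by
          refine hxa.trans (one_div_le_one_div_of_le (by positivity) ?_)
          gcongr
      _ = 1 / 2 * (1 / r) := by field_simp
      _ ≤ 1 / 2 * (m / r) := by gcongr
  have htest := hTiff s s' t t' q e hq
  change ‖F x - (if ‖T ![s, s', t, t', q, e]‖ ≤ (3 * m * l * q : ℕ)
    then g₂ ![s, s', t, t', q, e] * k₁ e else g₁ ![s, s', t, t', q, e] * k₂ e) /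
      (k₁ e * k₂ e : ℕ)‖ ≤ 1 / e
  push_cast
  split_ifs with ht
  · have ht' := htest.1 (by push_cast; exact ht)
    have hxT : x ∈ Metric.closedBall c (2 * (m / r)) := by
      rw [mem_closedBall_iff_norm]
      have := norm_sub_le_norm_sub_add_norm_sub x (ratPoint s s' t t' q) c
      linarith
    have := H₂ s s' t t' q e hq he x hxT hxa₂
    rwa [mul_comm (k₁ e : ℂ), mul_div_mul_right _ _ hk₁C]
  · have hxS : x ∈ S := by
      refine hx.resolve_right (fun hxB => ht ?_)
      rw [mem_closedBall_iff_norm] at hxB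
      have := norm_sub_le_norm_sub_add_norm_sub (ratPoint s s' t t' q) x c
      rw [norm_sub_rev _ x] at this
      have h3 := htest.2 (by linarith)
      push_cast at h3
      exact h3
    have := H₁ s s' t t' q e hq he x hxS hxa₁
    rwa [mul_div_mul_right _ _ hk₂C]

theorem approx_closedBall_of_hasOnOpen {F : ℂ → ℂ} {U : Set ℂ} {z : ℂ} {ε : ℝ} (hε : 0 < ε)
    (hU : Metric.ball z (2 * ε) ⊆ U) (hF : 𝓕.HasOnOpen (planeEquiv '' U) (realForm F)) :
    𝓕.Approx (Metric.closedBall z ε) F := by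
  obtain ⟨d, f, hmono, hd, hf, H⟩ := hF
  -- With `m` this large, the closed disc lies in the inner part of `U` at every precision `4 * e +
  -- m`; `2 / ε` allows for comparing Euclidean and maximum norms. The `4` pays for approximation
  -- and rounding in two coordinates.
  obtain ⟨m, hm⟩ := exists_nat_gt (max (‖z‖ + ε) (2 / ε))
  have hm1 : ‖z‖ + ε < m := (le_max_left _ _).trans_lt hm
  have hm2 : 2 / ε < m := (le_max_right _ _).trans_lt hm
  have hmR : (0 : ℝ) < m := lt_trans (by positivity) hm2
  have hd' : (fun v : Fin 1 → ℕ => d (v 0)) ∈ 𝓕 1 := hd (0 : Fin 1)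
  rw [has_rat_pow_iff] at hf
  have hprec : ∀ {n} (i : Fin n), (fun v : Fin n → ℕ => 4 * v i + m) ∈ 𝓕 n := fun i =>
    h.add (h.mul (h.const _ 4) (h.proj _ i)) (h.const _ m)
  have hcomp : ∀ b : (Fin 2 → ℚ) × ℕ → ℕ,
      (fun v : Fin 7 → ℕ => b (((Retract.rat.pow 2).prod Retract.nat).π v)) ∈ 𝓕 7 →
      (fun v : Fin 6 → ℕ => b (![((v 0 : ℚ) - v 1) / v 4, ((v 2 : ℚ) - v 3) / v 4],
        4 * v 5 + m)) ∈ 𝓕 6 := by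
    intro b hb
    simp only [ratPow_prod_nat_π] at hb
    refine h.comp 7 6 _ ![fun v => v 0, fun v => v 1, fun v => v 4, fun v => v 2, fun v => v 3,
      fun v => v 4, fun v => 4 * v 5 + m] hb ?_
    intro i
    fin_cases i
    exacts [h.proj 6 0, h.proj 6 1, h.proj 6 4, h.proj 6 2, h.proj 6 3, h.proj 6 4, hprec 5]
  let y : (Fin 6 → ℕ) → (Fin 2 → ℚ) × ℕ := fun v =>
    (![((v 0 : ℚ) - v 1) / v 4, ((v 2 : ℚ) - v 3) / v 4], 4 * v 5 + m)
  have hfloor : ∀ i, (fun v => scaledFloor (f (y v) i) (4 * v 5 + m)) ∈ 𝓕 6 ∧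
      (fun v => scaledFloor (-f (y v) i) (4 * v 5 + m)) ∈ 𝓕 6 := by
    intro i
    obtain ⟨h0, h1, h2⟩ := hf i
    have h0' := hcomp (fun x => (f x i).num.toNat) h0
    have h1' := hcomp (fun x => (-(f x i).num).toNat) h1
    have h2' := hcomp (fun x => (f x i).den) h2
    simp only [scaledFloor, Rat.num_neg_eq_neg_num, Rat.den_neg_eq_den]
    exact ⟨h.div (h.mul h0' (hprec 5)) h2', h.div (h.mul h1' (hprec 5)) h2'⟩
  refine ⟨fun e => d (4 * e + m) + 1, fun e => 4 * e + m,
    fun v => ((scaledFloor (f (y v) 0) (4 * v 5 + m) : ℂ) -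
      scaledFloor (-f (y v) 0) (4 * v 5 + m)) + ((scaledFloor (f (y v) 1) (4 * v 5 + m) : ℂ) -
      scaledFloor (-f (y v) 1) (4 * v 5 + m)) * Complex.I,
    h.add_one (h.comp₁ hd' (hprec 0)), hprec 0, fun e => Nat.succ_pos _, fun e => ?_,
    ⟨_, (hfloor 0).1, _, (hfloor 0).2, _, (hfloor 1).1, _, (hfloor 1).2, fun _ => rfl⟩, ?_⟩
  · have : 0 < m := by exact_mod_cast hmR
    exact Nat.add_pos_right _ this
  intro s s' t t' q e hq he x hx hxa
  set E := 4 * e + m with hE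
  have hE0 : 0 < E := by omega
  have hER : (m : ℝ) ≤ E := by exact_mod_cast Nat.le_add_left m (4 * e)
  have hE0R : (0 : ℝ) < E := by exact_mod_cast hE0
  have heR : (0 : ℝ) < e := by exact_mod_cast he
  rw [mem_closedBall_iff_norm] at hx
  have hcompare : ∀ w : ℂ, ‖planeEquiv w‖ ≤ ‖w‖ ∧ ‖w‖ ≤ 2 * ‖planeEquiv w‖ := by
    intro w
    constructor
    · rw [pi_norm_le_iff_of_nonneg (norm_nonneg _)]
      intro i
      fin_cases i
      · exact Complex.abs_re_le_norm w
      · exact Complex.abs_im_le_norm w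
    · have h0 : |w.re| ≤ ‖planeEquiv w‖ := norm_le_pi_norm (planeEquiv w) 0
      have h1 : |w.im| ≤ ‖planeEquiv w‖ := norm_le_pi_norm (planeEquiv w) 1
      have := Complex.norm_le_abs_re_add_abs_im w
      linarith
  have hsub : ∀ w w' : ℂ, planeEquiv w - planeEquiv w' = planeEquiv (w - w') := by
    intro w w'
    funext i
    fin_cases i <;> rfl
  have hxU : x ∈ U := hU (by rw [mem_ball_iff_norm]; linarith)
  have hxinner : planeEquiv x ∈ innerPart (planeEquiv '' U) E := by
    refine ⟨⟨x, hxU, rfl⟩, ?_, ?_⟩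
    · have h1 := (hcompare x).1
      have h2 : ‖x‖ ≤ ‖z‖ + ‖x - z‖ := by
        have := norm_add_le z (x - z)
        rwa [add_sub_cancel] at this
      linarith
    · intro u hu
      obtain ⟨w, rfl⟩ := planeEquiv.surjective u
      have hw : w ∉ U := fun hw => hu ⟨w, hw, rfl⟩
      have hwz : 2 * ε ≤ ‖w - z‖ := by
        by_contra hlt
        exact hw (hU (by rw [mem_ball_iff_norm]; linarith))
      rw [hsub]
      have h1 := (hcompare (x - w)).2
      have h2 := norm_sub_le_norm_sub_add_norm_sub w x z
      rw [norm_sub_rev w x] at h2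
      have h3 : 1 / (E : ℝ) ≤ ε / 2 := by
        rw [div_lt_iff₀ hε] at hm2
        rw [div_le_div_iff₀ hE0R (by norm_num)]
        nlinarith
      linarith
  have hdR : (0 : ℝ) < d E := by
    have : 0 < d E := lt_of_lt_of_le hE0 (hmono.id_le E)
    exact_mod_cast this
  have hpt : ratPoint s s' t t' q = planeEquiv.symm
      (fun i => (((y ![s, s', t, t', q, e]).1 i : ℚ) : ℝ)) := by
    change ratPoint s s' t t' q = ⟨((((s : ℚ) - s') / q : ℚ) : ℝ), ((((t : ℚ) - t') / q : ℚ) : ℝ)⟩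
    rw [Complex.mk_eq_add_mul_I]
    simp only [ratPoint]
    push_cast
    rw [add_div, mul_div_right_comm]
  have hclose : ‖planeEquiv x - fun i => (((y ![s, s', t, t', q, e]).1 i : ℚ) : ℝ)‖ <
      1 / (d E : ℝ) := by
    have e1 : (fun i => (((y ![s, s', t, t', q, e]).1 i : ℚ) : ℝ)) =
        planeEquiv (ratPoint s s' t t' q) := by rw [hpt, Equiv.apply_symm_apply]
    rw [e1, hsub]
    refine ((hcompare _).1.trans hxa).trans_lt (one_div_lt_one_div_of_lt hdR ?_)
    push_cast
    linarith
  have hmain := H E hE0 (y ![s, s', t, t', q, e]).1 (planeEquiv x) hxinner hclose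
  have hpair : ((y ![s, s', t, t', q, e]).1, E) = y ![s, s', t, t', q, e] := rfl
  rw [hpair] at hmain
  set r := f (y ![s, s', t, t', q, e]) with hr
  have hcoord := (pi_norm_lt_iff (by positivity)).1 hmain
  have hre : |(F x).re - r 0| < 1 / E := hcoord 0
  have him : |(F x).im - r 1| < 1 / E := hcoord 1
  have hre' := abs_sub_scaledFloor_le (r 0) hE0
  have him' := abs_sub_scaledFloor_le (r 1) hE0
  change ‖F x - (((scaledFloor (r 0) E : ℂ) - scaledFloor (-r 0) E) +
    ((scaledFloor (r 1) E : ℂ) - scaledFloor (-r 1) E) * Complex.I) / E‖ ≤ 1 / e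
  have e2 : (((scaledFloor (r 0) E : ℂ) - scaledFloor (-r 0) E) +
      ((scaledFloor (r 1) E : ℂ) - scaledFloor (-r 1) E) * Complex.I) / E =
      ((((scaledFloor (r 0) E : ℝ) - scaledFloor (-r 0) E) / E : ℝ) : ℂ) +
      ((((scaledFloor (r 1) E : ℝ) - scaledFloor (-r 1) E) / E : ℝ) : ℂ) * Complex.I := by
    push_cast
    rw [add_div, mul_div_right_comm]
  rw [e2]
  refine (Complex.norm_le_abs_re_add_abs_im _).trans ?_
  simp only [Complex.sub_re, Complex.sub_im, Complex.add_re, Complex.add_im, Complex.ofReal_re,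
    Complex.ofReal_im, Complex.re_ofReal_mul, Complex.im_ofReal_mul, Complex.I_re, Complex.I_im,
    mul_zero, mul_one, add_zero, zero_add]
  have t1 := abs_sub_le (F x).re (r 0) (((scaledFloor (r 0) E : ℝ) - scaledFloor (-r 0) E) / E)
  have t2 := abs_sub_le (F x).im (r 1) (((scaledFloor (r 1) E : ℝ) - scaledFloor (-r 1) E) / E)
  have h4 : 4 * (1 / (E : ℝ)) ≤ 1 / e := by
    rw [mul_one_div, div_le_div_iff₀ hE0R heR]
    have : (4 * e : ℝ) ≤ E := by exact_mod_cast Nat.le_add_right (4 * e) m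
    linarith
  linarith

/-! ### Propagation through the domain -/

/-- Approximability near a rational point propagates to a definite fraction of the disc of
holomorphy. -/
theorem approx_closedBall_of_small {F : ℂ → ℂ} {γ γ' δ δ' l : ℕ} (hl : 0 < l) {r ρ R : ℝ}
    (hr : 0 < r) (hρ : 0 < ρ) (hR : 64 * ρ < R)
    (hF : DifferentiableOn ℂ F (Metric.closedBall (ratPoint γ γ' δ δ' l) R))
    (hA : 𝓕.Approx (Metric.closedBall (ratPoint γ γ' δ δ' l) r) F) :
    𝓕.Approx (Metric.closedBall (ratPoint γ γ' δ δ' l) ρ) F := by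
  -- Capping the radius at `ρ` keeps `64` times it below `R`, so every doubling is legitimate.
  have key : ∀ i : ℕ, 𝓕.Approx (Metric.closedBall (ratPoint γ γ' δ δ' l) (min (2 ^ i * r) ρ)) F := by
    intro i
    induction i with
    | zero => exact hA.mono (Metric.closedBall_subset_closedBall (by simp))
    | succ i ih =>
      have h64 : 64 * min (2 ^ i * r) ρ < R := by
        have := min_le_right (2 ^ i * r) ρ
        linarith
      refine (h.approx_closedBall_two_mul hl (lt_min (by positivity) hρ) h64 hF ih).mono
        (Metric.closedBall_subset_closedBall ?_)
      rw [mul_min_of_nonneg _ _ (by norm_num : (0 : ℝ) ≤ 2), pow_succ']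
      refine min_le_min (by rw [mul_assoc]) (by linarith)
  obtain ⟨i, hi⟩ := pow_unbounded_of_one_lt (ρ / r) (one_lt_two)
  have := key i
  rw [div_lt_iff₀ hr] at hi
  rwa [min_eq_right hi.le] at this

/-- The points near which a holomorphic function is approximable form a relatively closed set. -/
theorem exists_approx_closedBall_of_mem_closure {F : ℂ → ℂ} {D : Set ℂ} (hD : IsOpen D)
    (hF : DifferentiableOn ℂ F D) {z : ℂ} (hz : z ∈ D)
    (hcl : z ∈ closure {w | ∃ ε > 0, 𝓕.Approx (Metric.closedBall w ε) F}) :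
    ∃ ε > 0, 𝓕.Approx (Metric.closedBall z ε) F := by
  obtain ⟨R, hR, hRD⟩ := Metric.isOpen_iff.1 hD z hz
  obtain ⟨w, ⟨ε, hε, hA⟩, hzw⟩ := Metric.mem_closure_iff.1 hcl (R / 1000) (by positivity)
  obtain ⟨s, s', t, t', q, hq, hc⟩ := exists_norm_sub_ratPoint_lt w
    (show 0 < min (ε / 2) (R / 1000) by positivity)
  set c := ratPoint s s' t t' q with hcdef
  rw [← dist_eq_norm] at hc
  have hc1 := hc.trans_le (min_le_left _ _)
  have hc2 := hc.trans_le (min_le_right _ _)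
  have hzc : dist z c ≤ R / 500 := by
    have := dist_triangle z w c
    linarith
  -- The centre `c` is within `R / 500` of `z`, so its disc of radius `R / 2` stays in `D`. Moreover
  -- `64 / 200 < 1 / 2`, and radius `R / 200` is enough to surround `z`.
  have hball : 𝓕.Approx (Metric.closedBall c (R / 200)) F := by
    refine h.approx_closedBall_of_small hq (r := ε / 2) (R := R / 2) (by positivity) (by positivity)
      (by linarith) (hF.mono (fun x hx => hRD ?_)) (hA.mono (Metric.closedBall_subset_closedBall' ?_))
    · rw [Metric.mem_closedBall] at hx
      rw [Metric.mem_ball]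
      have := dist_triangle x c z
      rw [dist_comm c z] at this
      have hx' : dist x c ≤ R / 2 := hx
      linarith
    · rw [dist_comm]
      have hc1' : dist w (ratPoint s s' t t' q) < ε / 2 := hc1
      linarith
  refine ⟨R / 500, by positivity, hball.mono (Metric.closedBall_subset_closedBall' ?_)⟩
  linarith

theorem approx_of_isCompact {F : ℂ → ℂ} {K : Set ℂ} (hK : IsCompact K)
    (hloc : ∀ z ∈ K, ∃ ε > 0, 𝓕.Approx (Metric.closedBall z ε) F) : 𝓕.Approx K F := by
  -- Gluing joins an arbitrary set to a disc, not two arbitrary sets; carrying `T` along lets the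
  -- compactness induction handle unions.
  have key : ∀ T, 𝓕.Approx T F → 𝓕.Approx (T ∪ K) F := by
    refine hK.induction_on (p := fun S => ∀ T, 𝓕.Approx T F → 𝓕.Approx (T ∪ S) F) ?_ ?_ ?_ ?_
    · intro T hT
      simpa using hT
    · intro S S' hSS' hS' T hT
      exact (hS' T hT).mono (Set.union_subset_union_right T hSS')
    · intro S S' hS hS' T hT
      rw [← Set.union_assoc]
      exact hS' _ (hS T hT)
    · intro z hz
      obtain ⟨ε, hε, hA⟩ := hloc z hz
      obtain ⟨s, s', t, t', q, hq, hc⟩ := exists_norm_sub_ratPoint_lt z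
        (show 0 < ε / 8 by positivity)
      -- A rational radius above `ε / 8` captures `z`; below `3 * ε / 8`, the doubled disc stays
      -- within `ε` of `z`.
      obtain ⟨ρ, hρ1, hρ2⟩ := exists_rat_btwn (show ε / 8 < 3 * ε / 8 by linarith)
      have hρ0 : 0 < ρ := by
        have : (0 : ℝ) < ρ := lt_trans (by positivity) hρ1
        exact_mod_cast this
      have hρnum : 0 < ρ.num := Rat.num_pos.2 hρ0
      have hρe : (ρ : ℝ) = (ρ.num.toNat : ℝ) / ρ.den := by
        have h1 : ((ρ.num.toNat : ℕ) : ℝ) = ((ρ.num : ℤ) : ℝ) := by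
          exact_mod_cast Int.toNat_of_nonneg hρnum.le
        rw [h1]
        exact_mod_cast (Rat.num_div_den ρ).symm
      rw [hρe] at hρ1 hρ2
      rw [← dist_eq_norm] at hc
      refine ⟨Metric.closedBall (ratPoint s s' t t' q) (ρ.num.toNat / ρ.den),
        mem_nhdsWithin_of_mem_nhds (Metric.closedBall_mem_nhds_of_mem ?_), fun T hT => ?_⟩
      · rw [Metric.mem_ball]
        linarith
      · refine h.approx_union_closedBall hq (by omega) ρ.den_pos hT (hA.mono
          (Metric.closedBall_subset_closedBall' ?_))
        rw [dist_comm]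
        linarith
  have := key ∅ (h.approx_empty F)
  rwa [Set.empty_union] at this

end FunClass.IsGood

theorem theorems (𝓕 : FunClass) (h𝓕 : 𝓕.IsGood)
    (D : Set ℂ) (hDopen : IsOpen D) (hDconn : IsConnected D)
    (F : ℂ → ℂ) (hF : DifferentiableOn ℂ F D)
    (hU : ∃ U : Set ℂ, IsOpen U ∧ U.Nonempty ∧ U ⊆ D ∧
      𝓕.HasOnOpen (planeEquiv '' U) (realForm F)) :
    ∀ K : Set ℂ, IsCompact K → K ⊆ D →
      𝓕.HasOnCompact (planeEquiv '' K) (realForm F) := by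
  intro K hK hKD
  obtain ⟨U, hUopen, ⟨z₀, hz₀⟩, hUD, hFU⟩ := hU
  set W : Set ℂ := {w | ∃ ε > 0, 𝓕.Approx (Metric.closedBall w ε) F} with hW
  have hWopen : IsOpen W := by
    rw [Metric.isOpen_iff]
    rintro w ⟨ε, hε, hA⟩
    refine ⟨ε / 2, by positivity, fun u hu => ⟨ε / 2, by positivity,
      hA.mono (Metric.closedBall_subset_closedBall' ?_)⟩⟩
    rw [Metric.mem_ball] at hu
    linarith
  have hz₀W : z₀ ∈ W := by
    obtain ⟨r, hr, hrU⟩ := Metric.isOpen_iff.1 hUopen z₀ hz₀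
    exact ⟨r / 2, by positivity, h𝓕.approx_closedBall_of_hasOnOpen (by positivity)
      (by rwa [mul_div_cancel₀ r (by norm_num : (2 : ℝ) ≠ 0)]) hFU⟩
  -- Connectedness: `W` is open, meets `D`, and contains its limit points in `D`.
  have hDW : D ⊆ W := hDconn.isPreconnected.subset_of_closure_inter_subset hWopen
    ⟨z₀, hUD hz₀, hz₀W⟩
    (fun z hz => h𝓕.exists_approx_closedBall_of_mem_closure hDopen hF hz.2 hz.1)
  exact h𝓕.hasOnCompact_of_approx (h𝓕.approx_of_isCompact hK (fun z hz => hDW (hKD hz)))
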